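/- Let $\Omega\subset\mathbb{R}^d$ be bounded and open, let $(\phi_j)_{j\in\mathbb{N}}$ be an orthonormal basis of $L^2(\Omega)$ consisting of eigenfunctions of $-\triangle_x$ on $\Omega$ with homogeneous Dirichlet boundary conditions (in the weak sense, $\phi_j\in H^1_0(\Omega)$), with eigenvalues $\lambda_j$. Functions of $-\triangle_x$ are defined through this basis. For $w\in L^2(\Omega)$ and $s\ge 0$ put $\|w\|_{H^s(\Omega)}^2=\sum_j\lambda_j^s\langle w,\phi_j\rangle^2\in[0,\infty]$, and $\|w\|_{L^2(0,\bar\ell;H^s(\Omega))}^2=\int_0^{\bar\ell}\|w(\cdot,y)\|_{H^s(\Omega)}^2\,dy$. Let $f,g\in L^2(\Omega)$ and let $u$ be a solution of the Cauchy problem $$-\triangle_x u-\partial_y^2u=0\ \text{ in }\Omega\times(0,\bar\ell),\qquad u=0\ \text{ on }\partial\Omega\times(0,\bar\ell),\qquad u(\cdot,0)=f,\quad \partial_yu(\cdot,0)=g\ \text{ in }\Omega ,$$ where $y\mapsto u(\cdot,y)\in L^2(\Omega)$ is differentiable on $(0,\bar\ell)$ with $u(\cdot,y)\in H^1_0(\Omega)$,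 the equation is understood weakly in $x$, i.e. $\frac{d}{dy}\langle\partial_yu(\cdot,y),v\rangle=\int_\Omega\nabla_xu(\cdot,y)\cdot\nabla v\,dx$ for all $v\in H_0^1(\Omega)$ and $y\in(0,\bar\ell)$, and $u(\cdot,0)=f$, $\frac{d}{dy}\langle u(\cdot,y),v\rangle|_{y=0^+}=\langle g,v\rangle$ for all $v\in H^1_0(\Omega)$. Put $$u_+=\tfrac12\bigl(u+\sqrt{-\triangle_x}^{\,-1}\partial_yu\bigr),\qquad u_{\pm0}=\tfrac12\bigl(f\pm\sqrt{-\triangle_x}^{\,-1}g\bigr),$$ and assume $u_+\in L^2(0,\bar\ell;H^{\sigma+1+1/p}(\Omega))$ for some $\sigma\ge0$, $p>1$. For each $\delta>0$ let noisy data $f^\delta,g^\delta\in L^2(\Omega)$ be given such that $u_{+0}^\delta=\frac12(f^\delta+\sqrt{-\triangle_x}^{\,-1}g^\delta)$ satisfies $\|u_{+0}^\delta-u_{+0}\|_{L^2(\Omega)}\le\delta$. Smooth them by Landweber iteration, $$v^{(0)}=0,\qquad v^{(i+1)}=v^{(i)}-A\bigl(v^{(i)}-u_{+0}^\delta\bigr),\qquad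 A=\mu(-\triangle_x)^{-(\sigma+1)},$$ with $\mu>0$ such that $\|A\|_{L^2\to L^2}\le1$, and let $u_{+0}^{\tilde\delta}=v^{(i_*)}$, where, for some fixed $l\in(0,\bar\ell)$, the index $i_*=i_*(\delta)\in\mathbb{N}$ is of the exact order of $l^{-2}\log\bigl(\|u_+(\cdot,l)\|_{L^2(\Omega)}/\delta\bigr)$ as $\delta\to0^+$ (with the convention $\log 0=0$ in the trivial case $u_+=0$). For an arbitrary fixed constant $C_2>0$ let $$\tilde\delta=\tilde\delta(\delta)=C_2\,l^{-1}\,\delta\,\sqrt{\log\bigl(\|u_+(\cdot,l)\|_{L^2(\Omega)}/\delta\bigr)} .$$ For $\alpha\in(0,1)$ consider the scheme obtained from the factorisation $-\triangle=(\partial_y-\sqrt{-\triangle_x})(-\partial_y-\sqrt{-\triangle_x})$ by replacing, in the backward problem for $u_+$, the first order derivative by the Djrbashian--Caputo derivative of order $\alpha$, while leaving $u_-$ unregularised, and by using $u_{+0}^{\tilde\delta}$ in place of $u_{+0}$; that is, $$u^{\alpha,\delta}(\cdot,y)=\sum_{j}\Bigl(\frac{\langle u_{+0}^{\tilde\delta},\phi_j\rangle}{E_{\alpha,1}(-\sqrt{\lambda_j}\,y^\alpha)}+\langle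 u_{-0},\phi_j\rangle\,e^{-\sqrt{\lambda_j}\,y}\Bigr)\phi_j,\qquad E_{\alpha,\beta}(z)=\sum_{k=0}^\infty\frac{z^k}{\Gamma(\alpha k+\beta)} .$$ Let the fractional order be chosen as a function $\alpha=\alpha(\tilde\delta)\in(0,1)$ such that $\alpha(\tilde\delta)\to1$ and $\Gamma(1-\alpha(\tilde\delta))\,\tilde\delta\to0$ as $\delta\to0^+$. Then for all sufficiently small $\delta>0$ the series defining $u^{\alpha(\tilde\delta),\delta}(\cdot,y)$ converges in $L^2(\Omega)$ for every $y\in(0,\bar\ell)$, and $$\bigl\|u-u^{\alpha(\tilde\delta),\delta}\bigr\|_{L^2(0,\bar\ell;H^\sigma(\Omega))}\to0\qquad\text{as }\delta\to0^+ .$$ -/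

import Mathlib

open MeasureTheory Filter Topology Set Asymptotics
open scoped ENNReal ContDiff

noncomputable section

/-- The real Hilbert space `L²(Ω)` for `Ω ⊆ ℝᵈ`. -/
abbrev L2 {d : ℕ} (Ω : Set (EuclideanSpace ℝ (Fin d))) : Type :=
  Lp ℝ 2 (volume.restrict Ω)

/-- The Hilbert space `L²(Ω; ℝᵈ)` of square integrable vector fields. -/
abbrev L2Field {d : ℕ} (Ω : Set (EuclideanSpace ℝ (Fin d))) : Type :=
  Lp (EuclideanSpace ℝ (Fin d)) 2 (volume.restrict Ω)

/-- `v ∈ H¹₀(Ω)` and `G` is its weak gradient: `(v, G)` is the limit in `L²(Ω) × L²(Ω; ℝᵈ)` of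
`(ψₙ, ∇ψₙ)` for some `ψₙ ∈ C_c^∞(Ω)`. -/
def HasH10Gradient {d : ℕ} (Ω : Set (EuclideanSpace ℝ (Fin d))) (v : L2 Ω) (G : L2Field Ω) :
    Prop :=
  ∃ ψ : ℕ → EuclideanSpace ℝ (Fin d) → ℝ,
    (∀ n, ContDiff ℝ ∞ (ψ n) ∧ HasCompactSupport (ψ n) ∧ tsupport (ψ n) ⊆ Ω) ∧
    Tendsto (fun n => eLpNorm (fun x => ψ n x - v x) 2 (volume.restrict Ω)) atTop (𝓝 0) ∧
    Tendsto (fun n => eLpNorm (fun x => gradient (ψ n) x - G x) 2 (volume.restrict Ω))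
      atTop (𝓝 0)

/-- `w` is in the domain of the Dirichlet Laplacian in the weak sense with `-Δw = lam w`:
`w ∈ H¹₀(Ω)` and `∫ ∇w · ∇v = lam ∫ w v` for all `v ∈ H¹₀(Ω)`. -/
def IsDirichletEigenfunction {d : ℕ} (Ω : Set (EuclideanSpace ℝ (Fin d))) (lam : ℝ) (w : L2 Ω) :
    Prop :=
  ∃ G : L2Field Ω, HasH10Gradient Ω w G ∧
    ∀ (v : L2 Ω) (Gv : L2Field Ω), HasH10Gradient Ω v Gv → inner ℝ G Gv = lam * inner ℝ w v

/-- `u` solves the Cauchy problem `-Δₓu - ∂_y²u = 0` in `Ω × (0, ℓ)`, `u = 0` on `∂Ω × (0, ℓ)`,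
`u(·, 0) = f`, `∂_y u(·, 0) = g`, with `u` regarded as the curve `y ↦ u(·, y)` in `L²(Ω)`.
The equation is understood weakly in `x`, by testing with `H¹₀(Ω)`; the lateral boundary condition
is `u(·, y) ∈ H¹₀(Ω)`. -/
structure IsCauchySolution {d : ℕ} (Ω : Set (EuclideanSpace ℝ (Fin d))) (ℓ : ℝ) (f g : L2 Ω)
    (u : ℝ → L2 Ω) : Prop where
  differentiableAt : ∀ y ∈ Ioo 0 ℓ, DifferentiableAt ℝ u y
  equation : ∀ y ∈ Ioo 0 ℓ, ∃ G : L2Field Ω, HasH10Gradient Ω (u y) G ∧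
    ∀ (v : L2 Ω) (Gv : L2Field Ω), HasH10Gradient Ω v Gv →
      HasDerivAt (fun z => inner ℝ (deriv u z) v) (inner ℝ G Gv) y
  initial_value : u 0 = f
  initial_deriv : ∀ (v : L2 Ω) (Gv : L2Field Ω), HasH10Gradient Ω v Gv →
    HasDerivWithinAt (fun z => inner ℝ (u z) v) (inner ℝ g v) (Ici 0) 0

/-- The two-parameter Mittag-Leffler function `E_{α,β}(z) = ∑ₖ zᵏ / Γ(αk + β)` on the real line. -/
def mittagLeffler (α β z : ℝ) : ℝ :=
  ∑' k : ℕ, z ^ k / Real.Gamma (α * k + β)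

section Spectral

variable {H : Type*} [NormedAddCommGroup H] [InnerProductSpace ℝ H]

/-- The series `∑ⱼ m(lamⱼ) ⟨φⱼ, w⟩ φⱼ` defining `m(B) w` converges, where `B` is the operator with
eigenbasis `φ` and eigenvalues `lam`. -/
def InSpectralDomain (φ : HilbertBasis ℕ ℝ H) (lam : ℕ → ℝ) (m : ℝ → ℝ) (w : H) : Prop :=
  Summable (fun j => (m (lam j) * inner ℝ (φ j) w) • φ j)

/-- The function `m(B) w = ∑ⱼ m(lamⱼ) ⟨φⱼ, w⟩ φⱼ` of the operator `B` with eigenbasis `φ` and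
eigenvalues `lam`, applied to `w`. -/
def spectralMul (φ : HilbertBasis ℕ ℝ H) (lam : ℕ → ℝ) (m : ℝ → ℝ) (w : H) : H :=
  ∑' j, (m (lam j) * inner ℝ (φ j) w) • φ j

/-- `B^{-1/2} w`; for the Dirichlet Laplacian this is `√(-Δₓ)⁻¹ w`. -/
def invSqrt (φ : HilbertBasis ℕ ℝ H) (lam : ℕ → ℝ) (w : H) : H :=
  spectralMul φ lam (fun x => 1 / √x) w

/-- `u₊₀ = ½ (f + √(-Δₓ)⁻¹ g)`, the initial value of the unstable component. -/
def plusData (φ : HilbertBasis ℕ ℝ H) (lam : ℕ → ℝ) (f g : H) : H :=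
  (1 / 2 : ℝ) • (f + invSqrt φ lam g)

/-- `u₋₀ = ½ (f - √(-Δₓ)⁻¹ g)`, the initial value of the stable component. -/
def minusData (φ : HilbertBasis ℕ ℝ H) (lam : ℕ → ℝ) (f g : H) : H :=
  (1 / 2 : ℝ) • (f - invSqrt φ lam g)

/-- `u₊(y) = ½ (u(y) + √(-Δₓ)⁻¹ ∂_y u(y))`, the unstable component of `u`. -/
def plusPart (φ : HilbertBasis ℕ ℝ H) (lam : ℕ → ℝ) (u : ℝ → H) (y : ℝ) : H :=
  (1 / 2 : ℝ) • (u y + invSqrt φ lam (deriv u y))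

/-- The squared norm `∑ⱼ lamⱼˢ |⟨φⱼ, w⟩|²` of `Hˢ(Ω)`, with value `∞` for `w ∉ Hˢ(Ω)`. -/
def sobolevSq (φ : HilbertBasis ℕ ℝ H) (lam : ℕ → ℝ) (s : ℝ) (w : H) : ℝ≥0∞ :=
  ∑' j, ENNReal.ofReal (lam j ^ s * (inner ℝ (φ j) w) ^ 2)

/-- The norm of `L²(0, ℓ; Hˢ(Ω))`, with value `∞` outside that space. -/
def normL2Sobolev (φ : HilbertBasis ℕ ℝ H) (lam : ℕ → ℝ) (ℓ s : ℝ) (w : ℝ → H) : ℝ≥0∞ :=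
  (∫⁻ y in Ioo 0 ℓ, sobolevSq φ lam s (w y)) ^ (1 / 2 : ℝ)

/-- The smoothing operator `A = μ (-Δₓ)^{-τ}`. -/
def smoothingOp (φ : HilbertBasis ℕ ℝ H) (lam : ℕ → ℝ) (μ τ : ℝ) (w : H) : H :=
  spectralMul φ lam (fun x => μ * x ^ (-τ)) w

/-- Landweber iteration `v⁽ⁱ⁺¹⁾ = v⁽ⁱ⁾ - A (v⁽ⁱ⁾ - b)`, `v⁽⁰⁾ = 0`. -/
def landweber (A : H → H) (b : H) : ℕ → H
  | 0 => 0
  | i + 1 => landweber A b i - A (landweber A b i - b)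

/-- The symbol `1 / E_{α,1}(-√lam y^α)` of the regularised backward propagator: replacing the
`t`-derivative in the backward problem for `u₊` by the Djrbashian-Caputo derivative of order `α`
turns `exp(√lam y)` into this factor. -/
def regSymbol (α y x : ℝ) : ℝ :=
  1 / mittagLeffler α 1 (-√x * y ^ α)

/-- The reconstruction at height `y` of the fractionally regularised factorised scheme of order `α`
from the initial values `p` for `u₊` and `q` for `u₋`: its `j`-th coefficient is
`pⱼ / E_{α,1}(-√lamⱼ y^α) + qⱼ exp(-√lamⱼ y)`. -/
def reconstruction (φ : HilbertBasis ℕ ℝ H) (lam : ℕ → ℝ) (α : ℝ) (p q : H) (y : ℝ) : H :=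
  spectralMul φ lam (regSymbol α y) p + spectralMul φ lam (fun x => Real.exp (-√x * y)) q

end Spectral

/-- The noise level of the smoothed data `δ̃ = C l⁻¹ δ √(log (M / δ))`. -/
def smoothedLevel (C l M δ : ℝ) : ℝ :=
  C * l⁻¹ * δ * √(Real.log (M / δ))

end

/-! Everything is diagonal in the eigenbasis. With `s = √λⱼ`, the `j`-th mode of `u` is `Pⱼ exp(s y)
+ Qⱼ exp(-s y)`, and that of `u₊` is `Pⱼ exp(s y)`. Landweber iteration multiplies the data by the
filter `Xⱼ = 1 - (1 - μ λⱼ^(-(σ+1)))^i`. The stable parts cancel, and with `R = 1 / E_{α,1}(-s y^α)`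
the error in mode `j` is `Pⱼ (exp(s y) - Xⱼ R) - Xⱼ R (b - P)ⱼ`, where `b` is the noisy datum: a
bias and a noise term.

Noise: `R ≤ 1 + Γ(1-α) s y^α` grows only linearly in `s`, and `Xⱼ² ≤ i μ λⱼ^(-(σ+1))`. Hence the
squared `H^σ` norm of the noise term is `O(Γ(1-α)² i δ²)`, which is `O((Γ(1-α) δ̃)²)` by the choice
of `i` (`smoothing_weight_le`, `noise_term_le`).

Bias: `Xⱼ → 1` and `R → exp(s y)` for each `j` and `y`, so dominated convergence in `(j, y)` applies
once `R ≤ C s^(1+1/p) exp(s y)` holds uniformly for `α ∈ [1/2, 1)` (`regSymbol_le_mul_exp`).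
Squaring gives `λ^(1+1/p)`, exactly the additional regularity of `u₊`. The uniform bound combines
the linear estimate, used when `1 - α ≥ exp(-s y) s^(-1/p)`, with `R ≤ exp(s y^α / α)`, used for `α`
closer to one.

Both bounds on `R` are lower bounds on `E_{α,1}(-x)`. They come from a comparison principle for the
fractional relaxation equation (`le_mittagLeffler_of_subsolution`), with the subsolutions `1 / (1 +
Γ(1-α) x)` and `exp(-x / Γ(1+α))`. -/

/-! ### Gamma function estimates -/

theorem half_le_Gamma {x : ℝ} (hx : 1 ≤ x) : 1 / 2 ≤ Real.Gamma x := by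
  rcases le_total 2 x with h | h
  · have := Real.Gamma_strictMonoOn_Ici.monotoneOn (self_mem_Ici (a := (2 : ℝ))) h h
    rw [Real.Gamma_two] at this
    linarith
  · have h1 := Real.Gamma_strictMonoOn_Ici.monotoneOn (self_mem_Ici (a := (2 : ℝ)))
      (show x + 1 ∈ Ici 2 by simp; linarith) (by linarith)
    rw [Real.Gamma_two, Real.Gamma_add_one (by linarith)] at h1
    have h2 := Real.Gamma_pos_of_pos (show 0 < x by linarith)
    nlinarith

theorem Gamma_le_one {x : ℝ} (h1 : 1 ≤ x) (h2 : x ≤ 2) : Real.Gamma x ≤ 1 := by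
  have h := Real.convexOn_Gamma.2 (show (1 : ℝ) ∈ Ioi 0 by simp) (show (2 : ℝ) ∈ Ioi 0 by simp)
    (show 0 ≤ 2 - x by linarith) (show 0 ≤ x - 1 by linarith) (by ring)
  simp only [smul_eq_mul, Real.Gamma_one, Real.Gamma_two] at h
  rw [show (2 - x) * 1 + (x - 1) * 2 = x by ring] at h
  linarith

/-- Substitute for monotonicity, which fails between 1 and 2 but only within the range `[1/2, 1]`.
It compares Mittag-Leffler series of different orders term by term. -/
theorem Gamma_le_two_mul_Gamma {x y : ℝ} (hx : 1 ≤ x) (hxy : x ≤ y) :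
    Real.Gamma x ≤ 2 * Real.Gamma y := by
  have hy := half_le_Gamma (hx.trans hxy)
  rcases le_total 2 x with h | h
  · have := Real.Gamma_strictMonoOn_Ici.monotoneOn h (h.trans hxy) hxy
    linarith
  · linarith [Gamma_le_one hx h]

/-- The point 2 lies between `1 + a` and 3, so convexity bounds `Γ(2) = 1` by a mean of `Γ(1 + a)`
and `Γ(3) = 2`. -/
theorem le_Gamma_one_add {a : ℝ} (h0 : 0 < a) (h1 : a ≤ 1) : a ≤ Real.Gamma (1 + a) := by
  have hpos : 0 < 2 - a := by linarith
  have h := Real.convexOn_Gamma.2 (show 1 + a ∈ Ioi 0 by simp; linarith)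
    (show (3 : ℝ) ∈ Ioi 0 by simp)
    (show 0 ≤ 1 / (2 - a) by positivity) (show 0 ≤ (1 - a) / (2 - a) by
      apply div_nonneg <;> linarith) (by field_simp; ring)
  have h3 : Real.Gamma 3 = 2 := by
    rw [show (3 : ℝ) = 2 + 1 by norm_num, Real.Gamma_add_one (by norm_num), Real.Gamma_two]
    norm_num
  have e : 1 / (2 - a) * (1 + a) + (1 - a) / (2 - a) * 3 = 2 := by field_simp; ring
  simp only [smul_eq_mul, h3, e, Real.Gamma_two] at h
  have e2 : 1 / (2 - a) * Real.Gamma (1 + a) + (1 - a) / (2 - a) * 2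
    = (Real.Gamma (1 + a) + (1 - a) * 2) / (2 - a) := by ring
  rw [e2, le_div_iff₀ hpos] at h
  linarith

/-- Log-convexity at `z + 1`, between `z + a` and `z + a + 1`, together with `z + a ≤ 2 z`.
Consecutive Mittag-Leffler coefficients therefore have ratio `O(k^(-a))`. -/
theorem Gamma_le_Gamma_add_mul {z a : ℝ} (hz : 1 ≤ z) (h0 : 0 < a) (h1 : a ≤ 1) :
    z ^ a * Real.Gamma z ≤ 2 * Real.Gamma (z + a) := by
  rcases h1.eq_or_lt with rfl | h1
  · rw [Real.Gamma_add_one (by linarith), Real.rpow_one]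
    have := Real.Gamma_pos_of_pos (show 0 < z by linarith)
    nlinarith
  have hza : 0 < z + a := by linarith
  have hz0 : 0 < z := by linarith
  have hG := Real.Gamma_pos_of_pos hza
  have hGz := Real.Gamma_pos_of_pos hz0
  have h := Real.Gamma_mul_add_mul_le_rpow_Gamma_mul_rpow_Gamma hza
    (show 0 < z + a + 1 by linarith) h0 (show 0 < 1 - a by linarith) (by ring)
  rw [Real.Gamma_add_one hza.ne', Real.mul_rpow hza.le hG.le,
    show a * (z + a) + (1 - a) * (z + a + 1) = z + 1 by ring, Real.Gamma_add_one hz0.ne'] at h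
  have e : Real.Gamma (z + a) ^ a * ((z + a) ^ (1 - a) * Real.Gamma (z + a) ^ (1 - a))
      = (z + a) ^ (1 - a) * Real.Gamma (z + a) := by
    rw [mul_left_comm, ← Real.rpow_add hG]
    simp
  rw [e] at h
  have h2 : (z + a) ^ (1 - a) ≤ 2 * z ^ (1 - a) := by
    calc (z + a) ^ (1 - a) ≤ (2 * z) ^ (1 - a) :=
          Real.rpow_le_rpow hza.le (by linarith) (by linarith)
      _ = 2 ^ (1 - a) * z ^ (1 - a) := Real.mul_rpow (by norm_num) hz0.le
      _ ≤ 2 ^ (1 : ℝ) * z ^ (1 - a) := by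
          gcongr
          · norm_num
          · linarith
      _ = _ := by rw [Real.rpow_one]
  have h3 : z * Real.Gamma z ≤ z ^ (1 - a) * (2 * Real.Gamma (z + a)) := by
    calc _ ≤ _ := h
      _ ≤ (2 * z ^ (1 - a)) * Real.Gamma (z + a) := by gcongr
      _ = _ := by ring
  have h4 : z = z ^ (1 - a) * z ^ a := by
    rw [← Real.rpow_add hz0]; simp
  rw [show z * Real.Gamma z = z ^ (1 - a) * (z ^ a * Real.Gamma z) by
    rw [← mul_assoc, ← h4]] at h3
  exact le_of_mul_le_mul_left h3 (by positivity)

/-! ### The Mittag-Leffler series and its limit as the order tends to one -/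

theorem summable_mittagLeffler {a : ℝ} (h0 : 0 < a) (h1 : a ≤ 1) (z : ℝ) :
    Summable fun k : ℕ => z ^ k / Real.Gamma (a * k + 1) := by
  rcases eq_or_ne z 0 with rfl | hz
  · refine summable_of_ne_finset_zero (s := {0}) fun k hk => ?_
    simp at hk
    simp [hk]
  have hG : ∀ k : ℕ, 0 < Real.Gamma (a * k + 1) := fun k =>
    Real.Gamma_pos_of_pos (by positivity)
  refine summable_of_ratio_test_tendsto_lt_one (l := 0) one_pos
    (Eventually.of_forall fun k => div_ne_zero (pow_ne_zero _ hz) (hG k).ne') ?_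
  have hlim : Tendsto (fun k : ℕ => 2 * |z| * (a * k + 1) ^ (-a)) atTop (𝓝 0) := by
    have : Tendsto (fun k : ℕ => a * (k : ℝ) + 1) atTop atTop :=
      tendsto_atTop_add_const_right _ _ (tendsto_natCast_atTop_atTop.const_mul_atTop h0)
    simpa using ((tendsto_rpow_neg_atTop h0).comp this).const_mul (2 * |z|)
  refine squeeze_zero (fun k => by positivity) (fun k => ?_) hlim
  have hz1 : 1 ≤ a * (k : ℝ) + 1 := by
    have : 0 ≤ a * (k : ℝ) := by positivity
    linarith
  have h := Gamma_le_Gamma_add_mul hz1 h0 h1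
  have e : a * ((k + 1 : ℕ) : ℝ) + 1 = a * k + 1 + a := by push_cast; ring
  rw [e]
  have hG' : 0 < Real.Gamma (a * k + 1 + a) := Real.Gamma_pos_of_pos (by positivity)
  rw [norm_div, norm_div, norm_pow, norm_pow, Real.norm_eq_abs, Real.norm_of_nonneg hG'.le,
    Real.norm_of_nonneg (hG k).le, pow_succ, Real.rpow_neg (by linarith)]
  have hzk : 0 < |z| ^ k := by positivity
  have hp : 0 < (a * (k : ℝ) + 1) ^ a := by positivity
  rw [show |z| ^ k * |z| / Real.Gamma (a * k + 1 + a) / (|z| ^ k / Real.Gamma (a * k + 1))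
    = |z| * (Real.Gamma (a * k + 1) / Real.Gamma (a * k + 1 + a)) by
      field_simp [(hG k).ne'], mul_comm 2, mul_assoc]
  refine mul_le_mul_of_nonneg_left ?_ (abs_nonneg _)
  rw [div_le_iff₀ hG', ← div_eq_mul_inv, div_mul_eq_mul_div, le_div_iff₀ hp]
  linarith

/-- The majorant depends neither on the order `a ≥ b` nor on `z` in the ball, so it serves dominated
convergence in both. -/
theorem abs_mittagLeffler_term_le {a b z R : ℝ} (h0 : 0 < b) (hb : b ≤ a) (hz : |z| ≤ R) (k : ℕ) :
    ‖z ^ k / Real.Gamma (a * k + 1)‖ ≤ 2 * (R ^ k / Real.Gamma (b * k + 1)) := by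
  have hbk : 0 ≤ b * (k : ℝ) := by positivity
  have hle : b * (k : ℝ) ≤ a * k := by gcongr
  have h := Gamma_le_two_mul_Gamma (x := b * k + 1) (y := a * k + 1) (by linarith) (by linarith)
  have hGb : 0 < Real.Gamma (b * k + 1) := Real.Gamma_pos_of_pos (by linarith)
  have hGa : 0 < Real.Gamma (a * k + 1) := Real.Gamma_pos_of_pos (by linarith)
  rw [norm_div, norm_pow, Real.norm_eq_abs, Real.norm_of_nonneg hGa.le, ← mul_div_assoc,
    div_le_div_iff₀ hGa hGb]
  have h2 : |z| ^ k ≤ R ^ k := by gcongr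
  have h3 : 0 ≤ |z| ^ k := by positivity
  have h4 : 0 ≤ R ^ k := h3.trans h2
  calc |z| ^ k * Real.Gamma (b * k + 1) ≤ R ^ k * (2 * Real.Gamma (a * k + 1)) := by gcongr
    _ = _ := by ring

theorem continuous_mittagLeffler {a : ℝ} (h0 : 0 < a) (h1 : a ≤ 1) :
    Continuous (mittagLeffler a 1) := by
  rw [continuous_iff_continuousAt]
  intro z
  refine tendsto_tsum_of_dominated_convergence
    ((summable_mittagLeffler h0 h1 (|z| + 1)).mul_left 2) (fun k => ?_) ?_
  · exact ((continuous_id.pow k).div_const _).tendsto z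
  · have : ∀ᶠ w in 𝓝 z, |w| < |z| + 1 :=
      continuous_abs.continuousAt.eventually_lt continuousAt_const (by simp)
    filter_upwards [this] with w hw k using abs_mittagLeffler_term_le h0 le_rfl hw.le k

theorem mittagLeffler_zero (a : ℝ) : mittagLeffler a 1 0 = 1 := by
  rw [mittagLeffler, tsum_eq_single 0]
  · simp
  · intro k hk
    simp [hk]

/-- As `a → 1`, the regularised symbol tends to the exact one. -/
theorem tendsto_mittagLeffler_exp {ι : Type*} {l : Filter ι} {a : ι → ℝ}
    (ha1 : Tendsto a l (𝓝 1)) (s : ℝ) {y : ℝ} (hy : 0 < y) :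
    Tendsto (fun i => mittagLeffler (a i) 1 (-s * y ^ (a i))) l (𝓝 (Real.exp (-s * y))) := by
  have hz : Tendsto (fun i => -s * y ^ (a i)) l (𝓝 (-s * y)) := by
    have := (Real.continuousAt_const_rpow (b := 1) hy.ne').tendsto.comp ha1
    rw [Real.rpow_one] at this
    exact this.const_mul _
  have e : Real.exp (-s * y) = ∑' k : ℕ, (-s * y) ^ k / Real.Gamma (1 * k + 1) := by
    rw [Real.exp_eq_exp_ℝ, NormedSpace.exp_eq_tsum_div]
    simp [Real.Gamma_nat_eq_factorial]
  rw [e]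
  -- Eventually the orders exceed 1/2, so the series of order 1/2 dominates.
  refine tendsto_tsum_of_dominated_convergence
    ((summable_mittagLeffler (a := 1 / 2) (by norm_num) (by norm_num) (|-s * y| + 1)).mul_left 2)
    (fun k => ?_) ?_
  · have hpos : (0 : ℝ) < 1 * k + 1 := by positivity
    refine (hz.pow k).div ?_ (Real.Gamma_pos_of_pos hpos).ne'
    have hc : ContinuousAt Real.Gamma (1 * k + 1) :=
      (Real.differentiableOn_Gamma_Ioi.differentiableAt (Ioi_mem_nhds hpos)).continuousAt
    exact hc.tendsto.comp ((ha1.mul_const _).add_const _)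
  · have h1 : ∀ᶠ i in l, |-s * y ^ (a i)| < |-s * y| + 1 :=
      hz.abs.eventually_lt_const (by simp)
    filter_upwards [h1, ha1.eventually_const_lt (show (1 / 2 : ℝ) < 1 by norm_num)] with i h2 h3 k
    exact abs_mittagLeffler_term_le (by norm_num) h3.le h2.le k

/-! ### Beta integrals and the Marchaud kernel -/

theorem real_betaIntegral {u v : ℝ} (hu : 0 < u) (hv : 0 < v) :
    IntegrableOn (fun t : ℝ => t ^ (u - 1) * (1 - t) ^ (v - 1)) (Ioo 0 1) ∧
      ∫ t in Ioo (0 : ℝ) 1, t ^ (u - 1) * (1 - t) ^ (v - 1)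
        = Real.Gamma u * Real.Gamma v / Real.Gamma (u + v) := by
  have hc := Complex.betaIntegral_convergent (u := u) (v := v) (by simpa) (by simpa)
  rw [intervalIntegrable_iff_integrableOn_Ioo_of_le (by simp)] at hc
  have key : EqOn (fun t : ℝ => ((t : ℂ) ^ ((u : ℂ) - 1) * (1 - (t : ℂ)) ^ ((v : ℂ) - 1)))
      (fun t : ℝ => ((t ^ (u - 1) * (1 - t) ^ (v - 1) : ℝ) : ℂ)) (Ioo 0 1) := by
    intro t ht
    have h1 : 0 ≤ 1 - t := by linarith [ht.2]
    have e1 := Complex.ofReal_cpow ht.1.le (u - 1)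
    have e2 := Complex.ofReal_cpow h1 (v - 1)
    push_cast at e1 e2 ⊢
    rw [e1, e2]
  have hi := (integrableOn_congr_fun key measurableSet_Ioo).1 hc
  refine ⟨by simpa [IntegrableOn] using hi.re, ?_⟩
  have hb := ProbabilityTheory.beta_eq_betaIntegralReal u v hu hv
  rw [ProbabilityTheory.beta] at hb
  rw [hb, Complex.betaIntegral, intervalIntegral.integral_of_le zero_le_one,
    integral_Ioc_eq_integral_Ioo, setIntegral_congr_fun measurableSet_Ioo key, integral_complex_ofReal,
    Complex.ofReal_re]

/-- Bernoulli's inequality for `b ≥ 1`, and `t ≤ t ^ b` otherwise. The factor `1 - t` compensates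
the kernel singularity `(1 - t)^(-a-1)`. -/
theorem one_sub_rpow_le {b t : ℝ} (hb : 0 ≤ b) (ht : t ∈ Ioo (0 : ℝ) 1) :
    1 - t ^ b ≤ (1 + b) * (1 - t) := by
  have h1t : 0 < 1 - t := by linarith [ht.2]
  rcases le_total 1 b with h | h
  · have := one_add_mul_self_le_rpow_one_add (s := t - 1) (by linarith [ht.1]) h
    rw [add_sub_cancel] at this
    nlinarith
  · have := Real.rpow_le_rpow_of_exponent_ge ht.1 ht.2.le h
    rw [Real.rpow_one] at this
    nlinarith [mul_nonneg hb h1t.le]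

/-- The kernel of the Djrbashian-Caputo derivative in Marchaud form. -/
noncomputable def marchaudKernel (a t : ℝ) : ℝ := a * (1 - t) ^ (-a - 1)

theorem marchaudKernel_nonneg {a t : ℝ} (ha : 0 < a) (ht : t ∈ Ioo (0 : ℝ) 1) :
    0 ≤ marchaudKernel a t := by
  have h1t : 0 < 1 - t := by linarith [ht.2]
  rw [marchaudKernel]
  positivity

theorem measurable_marchaudKernel (a : ℝ) : Measurable (marchaudKernel a) := by
  unfold marchaudKernel
  fun_prop

theorem integrableOn_marchaudKernel_mul {a : ℝ} (h0 : 0 < a) (h1 : a < 1) {g : ℝ → ℝ}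
    (hg : Measurable g) {C : ℝ} (hC : ∀ t ∈ Ioo (0 : ℝ) 1, |g t| ≤ C * (1 - t)) :
    IntegrableOn (fun t => marchaudKernel a t * g t) (Ioo 0 1) := by
  have hi := ((real_betaIntegral (u := 1) one_pos (show 0 < 1 - a by linarith)).1).const_mul (a * C)
  refine Integrable.mono' hi ((measurable_marchaudKernel a).mul hg).aestronglyMeasurable ?_
  refine (ae_restrict_iff' measurableSet_Ioo).2 (Eventually.of_forall fun t ht => ?_)
  have h1t : 0 < 1 - t := by linarith [ht.2]
  rw [norm_mul, Real.norm_of_nonneg (marchaudKernel_nonneg h0 ht), Real.norm_eq_abs]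
  calc marchaudKernel a t * |g t| ≤ marchaudKernel a t * (C * (1 - t)) :=
        mul_le_mul_of_nonneg_left (hC t ht) (marchaudKernel_nonneg h0 ht)
    _ = a * C * ((1 - t) ^ (-a - 1) * (1 - t) ^ (1 : ℝ)) := by
        rw [marchaudKernel, Real.rpow_one]; ring
    _ = _ := by
        rw [← Real.rpow_add h1t]
        simp only [sub_self, Real.rpow_zero, one_mul]
        ring_nf

theorem integrableOn_marchaudKernel_rpow {a b : ℝ} (h0 : 0 < a) (h1 : a < 1) (hb : 0 ≤ b) :
    IntegrableOn (fun t => marchaudKernel a t * (1 - t ^ b)) (Ioo 0 1) := by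
  refine integrableOn_marchaudKernel_mul h0 h1 (by fun_prop) (C := 1 + b) fun t ht => ?_
  rw [abs_of_nonneg]
  · exact one_sub_rpow_le hb ht
  · linarith [Real.rpow_le_one ht.1.le ht.2.le hb]

/-- Integration by parts: `(1 - t)^(-a) (1 - t^b)` has boundary values 1 at 0 and 0 at 1, which
gives the `-1`, and the remaining integral is `b B(b, 1-a)`. -/
theorem integral_marchaudKernel_rpow {a b : ℝ} (h0 : 0 < a) (h1 : a < 1) (hb : 0 < b) :
    ∫ t in Ioo (0 : ℝ) 1, marchaudKernel a t * (1 - t ^ b)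
      = Real.Gamma (1 - a) * Real.Gamma (b + 1) / Real.Gamma (b + 1 - a) - 1 := by
  obtain ⟨hbi, hbe⟩ := real_betaIntegral hb (show 0 < 1 - a by linarith)
  have hk := integrableOn_marchaudKernel_rpow h0 h1 hb.le
  have hd : ∀ t ∈ Ioo (0 : ℝ) 1, HasDerivAt (fun t : ℝ => (1 - t) ^ (-a) * (1 - t ^ b))
      (marchaudKernel a t * (1 - t ^ b) - b * (t ^ (b - 1) * (1 - t) ^ (1 - a - 1))) t := by
    intro t ht
    have h1t : 0 < 1 - t := by linarith [ht.2]
    have d1 := ((hasDerivAt_id t).const_sub 1).rpow_const (p := -a) (Or.inl h1t.ne')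
    have d2 := (Real.hasDerivAt_rpow_const (p := b) (Or.inl ht.1.ne')).const_sub 1
    refine (d1.mul d2).congr_deriv ?_
    simp only [id, marchaudKernel, show 1 - a - 1 = -a by ring]
    ring
  have l0 : Tendsto (fun t : ℝ => (1 - t) ^ (-a) * (1 - t ^ b)) (𝓝[>] 0) (𝓝 1) := by
    have c : ContinuousAt (fun t : ℝ => (1 - t) ^ (-a) * (1 - t ^ b)) 0 := by
      refine ContinuousAt.mul ?_ (continuousAt_const.sub
        (Real.continuousAt_rpow_const _ _ (Or.inr hb.le)))
      exact (continuousAt_const.sub continuousAt_id).rpow_const (Or.inl (by simp))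
    have := c.tendsto
    simp only [sub_zero, Real.one_rpow, Real.zero_rpow hb.ne', mul_one] at this
    exact this.mono_left nhdsWithin_le_nhds
  have l1 : Tendsto (fun t : ℝ => (1 - t) ^ (-a) * (1 - t ^ b)) (𝓝[<] 1) (𝓝 0) := by
    have c : Tendsto (fun t : ℝ => (1 + b) * (1 - t) ^ (1 - a)) (𝓝[<] 1) (𝓝 0) := by
      have : ContinuousAt (fun t : ℝ => (1 + b) * (1 - t) ^ (1 - a)) 1 :=
        continuousAt_const.mul ((continuousAt_const.sub continuousAt_id).rpow_const
          (Or.inr (by linarith)))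
      have := this.tendsto
      simp only [sub_self, Real.zero_rpow (show 1 - a ≠ 0 by linarith), mul_zero] at this
      exact this.mono_left nhdsWithin_le_nhds
    have hmem : Ioo (0 : ℝ) 1 ∈ 𝓝[<] (1 : ℝ) := Ioo_mem_nhdsLT one_pos
    refine tendsto_of_tendsto_of_tendsto_of_le_of_le' tendsto_const_nhds c ?_ ?_
    · filter_upwards [hmem] with t ht
      have h1t : 0 < 1 - t := by linarith [ht.2]
      have := Real.rpow_le_one ht.1.le ht.2.le hb.le
      exact mul_nonneg (by positivity) (by linarith)
    · filter_upwards [hmem] with t ht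
      have h1t : 0 < 1 - t := by linarith [ht.2]
      calc (1 - t) ^ (-a) * (1 - t ^ b) ≤ (1 - t) ^ (-a) * ((1 + b) * (1 - t)) := by
            gcongr
            exact one_sub_rpow_le hb.le ht
        _ = (1 + b) * ((1 - t) ^ (-a) * (1 - t) ^ (1 : ℝ)) := by rw [Real.rpow_one]; ring
        _ = _ := by rw [← Real.rpow_add h1t]; ring_nf
  have hint : IntervalIntegrable (fun t : ℝ => marchaudKernel a t * (1 - t ^ b)
      - b * (t ^ (b - 1) * (1 - t) ^ (1 - a - 1))) volume 0 1 := by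
    rw [intervalIntegrable_iff_integrableOn_Ioo_of_le zero_le_one]
    exact hk.sub (hbi.const_mul b)
  have h := intervalIntegral.integral_eq_sub_of_hasDerivAt_of_tendsto one_pos hd hint l0 l1
  rw [intervalIntegral.integral_of_le zero_le_one, integral_Ioc_eq_integral_Ioo,
    integral_sub hk (hbi.const_mul b), integral_const_mul, hbe] at h
  rw [Real.Gamma_add_one hb.ne', show b + 1 - a = b + (1 - a) by ring]
  rw [sub_eq_iff_eq_add] at h
  rw [h]
  ring

/-! ### The fractional relaxation equation and its comparison principle -/

/-- The terms of the Mittag-Leffler series at `-x`. -/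
noncomputable def mlTerm (a x : ℝ) (k : ℕ) : ℝ := (-x) ^ k / Real.Gamma (a * k + 1)

theorem mlTerm_scaled (a x : ℝ) {t : ℝ} (ht : 0 < t) (k : ℕ) :
    mlTerm a (x * t ^ a) k = mlTerm a x k * t ^ (a * k) := by
  rw [mlTerm, mlTerm, Real.rpow_mul_natCast ht.le, neg_mul_eq_neg_mul, mul_pow]
  ring

/-- The Gamma quotient produced by the Marchaud integral of a power shifts the index by one; this is
the relaxation equation read off the power series. -/
theorem mlTerm_mul_gamma {a : ℝ} (h0 : 0 < a) (x : ℝ) (k : ℕ) :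
    mlTerm a x (k + 1) * (Real.Gamma (1 - a) * Real.Gamma (a * ((k + 1 : ℕ) : ℝ) + 1) /
      Real.Gamma (a * ((k + 1 : ℕ) : ℝ) + 1 - a)) = -x * Real.Gamma (1 - a) * mlTerm a x k := by
  have e : a * ((k + 1 : ℕ) : ℝ) + 1 - a = a * k + 1 := by push_cast; ring
  have h1 : 0 < Real.Gamma (a * ((k + 1 : ℕ) : ℝ) + 1) := Real.Gamma_pos_of_pos (by positivity)
  have h2 : 0 < Real.Gamma (a * k + 1) := Real.Gamma_pos_of_pos (by positivity)
  rw [e, mlTerm, mlTerm]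
  field_simp
  ring

theorem hasSum_mlTerm {a : ℝ} (h0 : 0 < a) (h1 : a ≤ 1) (x : ℝ) :
    HasSum (mlTerm a x) (mittagLeffler a 1 (-x)) :=
  (summable_mittagLeffler h0 h1 (-x)).hasSum

theorem abs_mlTerm {a : ℝ} (h0 : 0 < a) (x : ℝ) (k : ℕ) :
    |mlTerm a x k| = |x| ^ k / Real.Gamma (a * k + 1) := by
  have : 0 < Real.Gamma (a * k + 1) := Real.Gamma_pos_of_pos (by positivity)
  rw [mlTerm, abs_div, abs_pow, abs_neg, abs_of_pos this]

theorem mittagLeffler_sub_scaled {a : ℝ} (h0 : 0 < a) (h1 : a ≤ 1) (x : ℝ) {t : ℝ} (ht : 0 < t) :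
    HasSum (fun k : ℕ => mlTerm a x k * (1 - t ^ (a * k)))
      (mittagLeffler a 1 (-x) - mittagLeffler a 1 (-(x * t ^ a))) := by
  refine ((hasSum_mlTerm h0 h1 x).sub (hasSum_mlTerm h0 h1 (x * t ^ a))).congr_fun fun k => ?_
  rw [mlTerm_scaled a x ht]
  ring

theorem integrableOn_marchaudKernel_mittagLeffler {a : ℝ} (h0 : 0 < a) (h1 : a < 1) (x : ℝ) :
    IntegrableOn (fun t => marchaudKernel a t *
      (mittagLeffler a 1 (-x) - mittagLeffler a 1 (-(x * t ^ a)))) (Ioo 0 1) := by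
  have hm : Measurable fun t : ℝ => mittagLeffler a 1 (-x) - mittagLeffler a 1 (-(x * t ^ a)) :=
    measurable_const.sub ((continuous_mittagLeffler h0 h1.le).measurable.comp (by fun_prop))
  have hs := (summable_mittagLeffler h0 h1.le (2 * |x|)).mul_left 2
  refine integrableOn_marchaudKernel_mul h0 h1 hm
    (C := ∑' k : ℕ, 2 * ((2 * |x|) ^ k / Real.Gamma (a * k + 1))) fun t ht => ?_
  have h1t : 0 < 1 - t := by linarith [ht.2]
  have hsum := mittagLeffler_sub_scaled h0 h1.le x ht.1
  rw [← hsum.tsum_eq, ← Real.norm_eq_abs, ← tsum_mul_right]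
  refine tsum_of_norm_bounded (hs.mul_right (1 - t)).hasSum fun k => ?_
  have hak : 0 ≤ a * (k : ℝ) := by positivity
  have hle := one_sub_rpow_le hak ht
  have hnn : 0 ≤ 1 - t ^ (a * k) := by linarith [Real.rpow_le_one ht.1.le ht.2.le hak]
  have hG : 0 < Real.Gamma (a * k + 1) := Real.Gamma_pos_of_pos (by positivity)
  -- The linear factor `1 + a k` is absorbed by doubling the argument of the series.
  have hk : 1 + a * (k : ℝ) ≤ 2 * 2 ^ k := by
    have h2 : (k : ℝ) ≤ 2 ^ k := by exact_mod_cast Nat.lt_two_pow_self.le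
    have h3 : (1 : ℝ) ≤ 2 ^ k := one_le_pow₀ (by norm_num)
    have h4 : a * (k : ℝ) ≤ k := mul_le_of_le_one_left (by positivity) h1.le
    linarith
  rw [norm_mul, Real.norm_eq_abs, abs_mlTerm h0, Real.norm_of_nonneg hnn]
  calc |x| ^ k / Real.Gamma (a * k + 1) * (1 - t ^ (a * k))
      ≤ |x| ^ k / Real.Gamma (a * k + 1) * (2 * 2 ^ k * (1 - t)) := by
        gcongr
        exact hle.trans (by gcongr)
    _ = _ := by rw [mul_pow]; ring

/-- The relaxation equation `D^a u = -x u` for `u(t) = E_{a,1}(-x t^a)`, at `t = 1`. -/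
theorem mittagLeffler_relaxation {a : ℝ} (h0 : 0 < a) (h1 : a < 1) (x : ℝ) :
    mittagLeffler a 1 (-x) - 1 + ∫ t in Ioo (0 : ℝ) 1, marchaudKernel a t *
      (mittagLeffler a 1 (-x) - mittagLeffler a 1 (-(x * t ^ a)))
      = -x * Real.Gamma (1 - a) * mittagLeffler a 1 (-x) := by
  -- The index starts at `k + 1`: the constant term of the series drops out of the difference.
  set F : ℕ → ℝ → ℝ := fun k t => mlTerm a x (k + 1) *
    (marchaudKernel a t * (1 - t ^ (a * ((k + 1 : ℕ) : ℝ)))) with hF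
  have hpos : ∀ k : ℕ, 0 < a * ((k + 1 : ℕ) : ℝ) := fun k => by positivity
  have hFi : ∀ k, Integrable (F k) (volume.restrict (Ioo 0 1)) := fun k =>
    (integrableOn_marchaudKernel_rpow h0 h1 (hpos k).le).const_mul _
  have hs := summable_mittagLeffler h0 h1.le |x|
  -- Each `F k` has constant sign on `(0, 1)`, so its `L¹` norm is given by the same explicit
  -- formula, and summability reduces to that of the series at `|x|`.
  have habs : ∀ k, ∫ t in Ioo (0 : ℝ) 1, ‖F k t‖ = |x| * Real.Gamma (1 - a) *
      (|x| ^ k / Real.Gamma (a * k + 1)) - |x| ^ (k + 1) / Real.Gamma (a * ((k + 1 : ℕ) : ℝ) + 1) := by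
    intro k
    have e : EqOn (fun t => ‖F k t‖) (fun t => |mlTerm a x (k + 1)| *
        (marchaudKernel a t * (1 - t ^ (a * ((k + 1 : ℕ) : ℝ))))) (Ioo 0 1) := by
      intro t ht
      have hnn : 0 ≤ 1 - t ^ (a * ((k + 1 : ℕ) : ℝ)) := by
        linarith [Real.rpow_le_one ht.1.le ht.2.le (hpos k).le]
      simp only [hF, norm_mul, Real.norm_eq_abs, abs_of_nonneg hnn,
        abs_of_nonneg (marchaudKernel_nonneg h0 ht)]
    rw [setIntegral_congr_fun measurableSet_Ioo e, integral_const_mul,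
      integral_marchaudKernel_rpow h0 h1 (hpos k), abs_mlTerm h0]
    have g1 : 0 < Real.Gamma (a * ((k + 1 : ℕ) : ℝ) + 1) := Real.Gamma_pos_of_pos (by positivity)
    have g2 : 0 < Real.Gamma (a * k + 1) := Real.Gamma_pos_of_pos (by positivity)
    rw [show a * ((k + 1 : ℕ) : ℝ) + 1 - a = a * k + 1 by push_cast; ring]
    field_simp
    ring
  have hFs : Summable fun k => ∫ t in Ioo (0 : ℝ) 1, ‖F k t‖ := by
    simp_rw [habs]
    exact (hs.mul_left _).sub ((summable_nat_add_iff 1).2 hs)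
  have h := hasSum_integral_of_summable_integral_norm hFi hFs
  have e1 : ∀ k, ∫ t in Ioo (0 : ℝ) 1, F k t
      = -x * Real.Gamma (1 - a) * mlTerm a x k - mlTerm a x (k + 1) := by
    intro k
    rw [hF]
    simp only
    rw [integral_const_mul, integral_marchaudKernel_rpow h0 h1 (hpos k), mul_sub,
      mlTerm_mul_gamma h0, mul_one]
  have e2 : EqOn (fun t => ∑' k, F k t) (fun t => marchaudKernel a t *
      (mittagLeffler a 1 (-x) - mittagLeffler a 1 (-(x * t ^ a)))) (Ioo 0 1) := by
    intro t ht
    have hsum := mittagLeffler_sub_scaled h0 h1.le x ht.1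
    have h2 := (hasSum_nat_add_iff' 1).2 hsum
    simp only [Finset.range_one, Finset.sum_singleton, Nat.cast_zero, mul_zero, Real.rpow_zero,
      sub_self, sub_zero] at h2
    refine Eq.trans ?_ (h2.mul_left (marchaudKernel a t)).tsum_eq
    exact tsum_congr fun k => by simp only [hF]; ring
  simp_rw [e1] at h
  rw [setIntegral_congr_fun measurableSet_Ioo e2] at h
  have hE := hasSum_mlTerm h0 h1.le x
  have hE1 := (hasSum_nat_add_iff' 1).2 hE
  simp only [Finset.range_one, Finset.sum_singleton] at hE1
  have h3 := (hE.mul_left (-x * Real.Gamma (1 - a))).sub hE1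
  have h4 := h.unique h3
  have e3 : mlTerm a x 0 = 1 := by simp [mlTerm]
  rw [h4, e3]
  ring

/-- Comparison principle: subsolutions of the relaxation equation lie below `E_{a,1}(-x)`. -/
theorem le_mittagLeffler_of_subsolution {a : ℝ} (h0 : 0 < a) (h1 : a < 1) {W : ℝ → ℝ}
    (hWc : ContinuousOn W (Ici 0)) (hW0 : W 0 = 1)
    (hW : ∀ x, 0 < x → ∃ g : ℝ → ℝ, (∀ t ∈ Ioo (0 : ℝ) 1, W x - W (x * t ^ a) ≤ g t) ∧
      IntegrableOn (fun t => marchaudKernel a t * g t) (Ioo 0 1) ∧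
      W x - 1 + ∫ t in Ioo (0 : ℝ) 1, marchaudKernel a t * g t ≤ -x * Real.Gamma (1 - a) * W x)
    {x : ℝ} (hx : 0 ≤ x) : W x ≤ mittagLeffler a 1 (-x) := by
  by_contra! hlt
  set Z : ℝ → ℝ := fun x => mittagLeffler a 1 (-x) - W x with hZ
  have hZc : ContinuousOn Z (Icc 0 x) :=
    (((continuous_mittagLeffler h0 h1.le).comp continuous_neg).continuousOn).sub
      (hWc.mono Icc_subset_Ici_self)
  -- At a negative minimum `x0` of `Z`, the increments of the Mittag-Leffler function from `x0 t^a`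
  -- to `x0` are at most those of `W`, hence at most `g`. Subtracting the two relations yields `Z x0
  -- ≥ -x0 Γ(1-a) Z x0 > 0`, a contradiction.
  obtain ⟨x0, hx0, hmin⟩ := isCompact_Icc.exists_isMinOn (nonempty_Icc.2 hx) hZc
  have hneg : Z x0 < 0 := (hmin (right_mem_Icc.2 hx)).trans_lt (sub_neg.2 hlt)
  have hx0pos : 0 < x0 := by
    refine hx0.1.lt_of_ne fun h => ?_
    rw [← h] at hneg
    simp [hZ, hW0, mittagLeffler_zero] at hneg
  obtain ⟨g, hg, hgi, hgle⟩ := hW x0 hx0pos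
  have hrel := mittagLeffler_relaxation h0 h1 x0
  have hmono : ∫ t in Ioo (0 : ℝ) 1, marchaudKernel a t *
      (mittagLeffler a 1 (-x0) - mittagLeffler a 1 (-(x0 * t ^ a))) ≤
      ∫ t in Ioo (0 : ℝ) 1, marchaudKernel a t * g t := by
    refine setIntegral_mono_on (integrableOn_marchaudKernel_mittagLeffler h0 h1 x0) hgi
      measurableSet_Ioo fun t ht => ?_
    refine mul_le_mul_of_nonneg_left ?_ (marchaudKernel_nonneg h0 ht)
    have hta : t ^ a ≤ 1 := Real.rpow_le_one ht.1.le ht.2.le h0.le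
    have hta0 : 0 ≤ t ^ a := Real.rpow_nonneg ht.1.le a
    have hm : Z x0 ≤ Z (x0 * t ^ a) :=
      hmin ⟨by positivity, (mul_le_of_le_one_right hx0pos.le hta).trans hx0.2⟩
    have := hg t ht
    simp only [hZ] at hm
    linarith
  have hG : 0 < Real.Gamma (1 - a) := Real.Gamma_pos_of_pos (by linarith)
  have : 0 < -x0 * Real.Gamma (1 - a) * Z x0 :=
    mul_pos_of_neg_of_neg (by nlinarith) hneg
  simp only [hZ] at this hneg
  nlinarith

/-- The candidate is decreasing, so its increments are nonpositive and `g = 0` is admissible; the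
relation without the integral then holds with equality. -/
theorem one_div_one_add_le_mittagLeffler {a : ℝ} (h0 : 0 < a) (h1 : a < 1) {x : ℝ} (hx : 0 ≤ x) :
    1 / (1 + Real.Gamma (1 - a) * x) ≤ mittagLeffler a 1 (-x) := by
  have hG : 0 < Real.Gamma (1 - a) := Real.Gamma_pos_of_pos (by linarith)
  refine le_mittagLeffler_of_subsolution h0 h1 (W := fun x => 1 / (1 + Real.Gamma (1 - a) * x))
    ?_ (by simp) (fun x hx => ⟨fun _ => 0, fun t ht => ?_, by simp, ?_⟩) hx
  · refine continuousOn_const.div (by fun_prop) fun x hx => ?_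
    have : 0 ≤ x := hx
    positivity
  · have hta : t ^ a ≤ 1 := Real.rpow_le_one ht.1.le ht.2.le h0.le
    have hta0 : 0 ≤ t ^ a := Real.rpow_nonneg ht.1.le a
    refine sub_nonpos.2 (one_div_le_one_div_of_le (by positivity) ?_)
    gcongr
    exact mul_le_of_le_one_right hx.le hta
  · have : 0 < 1 + Real.Gamma (1 - a) * x := by positivity
    simp only [mul_zero, integral_zero, add_zero]
    field_simp
    linarith

/-- With `v = x / Γ(1+a)`, convexity of the exponential bounds the increments by `-exp(-v) v (1 -
t^a)`, whose Marchaud integral is explicit. The rate `1 / Γ(1+a)` cancels the terms with `Γ(1-a)`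
and leaves `(1 + v) exp(-v) ≤ 1`. -/
theorem exp_le_mittagLeffler {a : ℝ} (h0 : 0 < a) (h1 : a < 1) {x : ℝ} (hx : 0 ≤ x) :
    Real.exp (-(x / Real.Gamma (1 + a))) ≤ mittagLeffler a 1 (-x) := by
  have hG : 0 < Real.Gamma (1 + a) := Real.Gamma_pos_of_pos (by linarith)
  refine le_mittagLeffler_of_subsolution h0 h1 (W := fun x => Real.exp (-(x / Real.Gamma (1 + a))))
    (by fun_prop) (by simp) (fun x hx => ⟨fun t => -(Real.exp (-(x / Real.Gamma (1 + a))) *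
      (x / Real.Gamma (1 + a))) * (1 - t ^ a), fun t ht => ?_, ?_, ?_⟩) hx
  · have h := Real.add_one_le_exp (x / Real.Gamma (1 + a) * (1 - t ^ a))
    have e : Real.exp (-(x * t ^ a / Real.Gamma (1 + a)))
        = Real.exp (-(x / Real.Gamma (1 + a))) *
          Real.exp (x / Real.Gamma (1 + a) * (1 - t ^ a)) := by
      rw [← Real.exp_add]; ring_nf
    simp only [e]
    have := mul_le_mul_of_nonneg_left h (Real.exp_pos (-(x / Real.Gamma (1 + a)))).le
    nlinarith
  · simp_rw [mul_left_comm (marchaudKernel a _)]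
    exact (integrableOn_marchaudKernel_rpow h0 h1 h0.le).const_mul _
  · simp_rw [mul_left_comm (marchaudKernel a _)]
    rw [integral_const_mul, integral_marchaudKernel_rpow h0 h1 h0,
      show a + 1 - a = 1 by ring, Real.Gamma_one, add_comm a 1]
    have h := Real.add_one_le_exp (x / Real.Gamma (1 + a))
    have h2 := mul_le_mul_of_nonneg_left h (Real.exp_pos (-(x / Real.Gamma (1 + a)))).le
    rw [← Real.exp_add, neg_add_cancel, Real.exp_zero] at h2
    have e : x / Real.Gamma (1 + a) * Real.Gamma (1 + a) = x := by field_simp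
    set v := x / Real.Gamma (1 + a)
    set w := Real.exp (-v)
    have e2 : -(w * v) * (Real.Gamma (1 - a) * Real.Gamma (1 + a) / 1 - 1)
      = - w * Real.Gamma (1 - a) * (v * Real.Gamma (1 + a)) + w * v := by ring
    rw [e2, e]
    linarith

theorem mittagLeffler_pos {a : ℝ} (h0 : 0 < a) (h1 : a < 1) {x : ℝ} (hx : 0 ≤ x) :
    0 < mittagLeffler a 1 (-x) :=
  (Real.exp_pos _).trans_le (exp_le_mittagLeffler h0 h1 hx)

/-! ### Bounds on the regularised symbol -/

theorem regSymbol_pos {a y x : ℝ} (h0 : 0 < a) (h1 : a < 1) (hy : 0 ≤ y) :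
    0 < regSymbol a y x := by
  rw [regSymbol, neg_mul]
  exact one_div_pos.2 (mittagLeffler_pos h0 h1 (by positivity))

theorem regSymbol_le {a y x : ℝ} (h0 : 0 < a) (h1 : a < 1) (hy : 0 ≤ y) :
    regSymbol a y x ≤ 1 + Real.Gamma (1 - a) * (√x * y ^ a) := by
  have hG : 0 < Real.Gamma (1 - a) := Real.Gamma_pos_of_pos (by linarith)
  have hx : 0 ≤ √x * y ^ a := by positivity
  rw [regSymbol, neg_mul, one_div_le (mittagLeffler_pos h0 h1 hx) (by positivity)]
  exact one_div_one_add_le_mittagLeffler h0 h1 hx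

/-- Unlike the linear bound, this one does not degenerate as `a → 1`, where `Γ(1-a)` blows up. -/
theorem regSymbol_le_exp {a y x : ℝ} (h0 : 0 < a) (h1 : a < 1) (hy : 0 ≤ y) :
    regSymbol a y x ≤ Real.exp (√x * y ^ a / a) := by
  have hG := le_Gamma_one_add h0 h1.le
  have hx : 0 ≤ √x * y ^ a := by positivity
  have h := exp_le_mittagLeffler h0 h1 hx
  have h2 : Real.exp (-(√x * y ^ a / a)) ≤ mittagLeffler a 1 (-(√x * y ^ a)) := by
    refine le_trans (Real.exp_le_exp.2 (neg_le_neg ?_)) h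
    gcongr
  rw [regSymbol, neg_mul, one_div_le (mittagLeffler_pos h0 h1 hx) (Real.exp_pos _), one_div,
    ← Real.exp_neg]
  exact h2

theorem rpow_le_max {y a L : ℝ} (hy : 0 ≤ y) (hyL : y ≤ L) (h0 : 0 ≤ a) (h1 : a ≤ 1) :
    y ^ a ≤ 1 + L := by
  have := Real.rpow_le_rpow hy (show y ≤ 1 + y by linarith) h0
  have h2 := Real.rpow_le_rpow_of_exponent_le (show 1 ≤ 1 + y by linarith) h1
  rw [Real.rpow_one] at h2
  linarith

theorem tendsto_regSymbol {ι : Type*} {l : Filter ι} {a : ι → ℝ}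
    (ha1 : Tendsto a l (𝓝 1)) (x : ℝ) {y : ℝ} (hy : 0 < y) :
    Tendsto (fun i => regSymbol (a i) y x) l (𝓝 (Real.exp (√x * y))) := by
  have := (tendsto_mittagLeffler_exp ha1 (√x) hy).inv₀ (Real.exp_pos _).ne'
  rw [← Real.exp_neg, neg_mul, neg_neg] at this
  refine this.congr fun i => ?_
  rw [regSymbol, one_div]

theorem measurable_regSymbol {a : ℝ} (h0 : 0 < a) (h1 : a ≤ 1) (x : ℝ) :
    Measurable fun y => regSymbol a y x := by
  unfold regSymbol
  exact measurable_const.div ((continuous_mittagLeffler h0 h1).measurable.comp (by fun_prop))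

/-- For orders close to one relative to `exp (-s y)`, the scaled argument is close to `s y`. -/
theorem mul_rpow_le_add {e : ℝ} (he : 0 < e) : ∃ C, 0 ≤ C ∧ ∀ a s y : ℝ, 0 < a → a < 1 → 0 < s →
    0 < y → 1 - a < Real.exp (-(s * y)) * s ^ (-e) → s * y ^ a ≤ s * y + C := by
  -- The summand `exp(1/e)` covers `s y ≤ 1`, and `exp(1/e) / e` covers `s y ≥ 1`.
  refine ⟨Real.exp (1 / e) * (1 + 1 / e), by positivity, fun a s y h0 h1 hs hy h => ?_⟩
  set z := s * y with hz
  have hz0 : 0 < z := by positivity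
  -- The excess over `z ^ a` is the factor `s^(1-a)`. Since `(log s) s^(-e) ≤ 1/e`, it is `1 +
  -- O(exp(-z))`, and `z exp(-z) ≤ 1` keeps the total excess bounded.
  have hx : s * y ^ a = s ^ (1 - a) * z ^ a := by
    rw [hz, Real.mul_rpow hs.le hy.le, ← mul_assoc, ← Real.rpow_add hs]
    simp
  have hlog : Real.log s * s ^ (-e) ≤ 1 / e := by
    have h2 := Real.log_le_rpow_div hs.le he
    have h3 : 0 < s ^ (-e) := by positivity
    calc Real.log s * s ^ (-e) ≤ s ^ e / e * s ^ (-e) := by gcongr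
      _ = s ^ e * s ^ (-e) / e := by ring
      _ = 1 / e := by rw [← Real.rpow_add hs]; simp
  have hw : 0 < Real.exp (-z) := Real.exp_pos _
  have hw1 : Real.exp (-z) ≤ 1 := Real.exp_le_one_iff.2 (by linarith)
  have hsb : s ^ (1 - a) ≤ Real.exp (Real.exp (-z) * (1 / e)) := by
    rw [Real.rpow_def_of_pos hs]
    refine Real.exp_le_exp.2 ?_
    rcases le_total 0 (Real.log s) with hl | hl
    · calc Real.log s * (1 - a) ≤ Real.log s * (Real.exp (-z) * s ^ (-e)) := by gcongr
        _ = Real.exp (-z) * (Real.log s * s ^ (-e)) := by ring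
        _ ≤ _ := by gcongr
    · have : Real.log s * (1 - a) ≤ 0 := mul_nonpos_of_nonpos_of_nonneg hl (by linarith)
      exact this.trans (by positivity)
  have hsb1 : s ^ (1 - a) ≤ Real.exp (1 / e) :=
    hsb.trans (Real.exp_le_exp.2 (mul_le_of_le_one_left (by positivity) hw1))
  have hE : 0 < Real.exp (1 / e) := Real.exp_pos _
  rw [hx]
  rcases le_total z 1 with h1z | h1z
  · have : z ^ a ≤ 1 := Real.rpow_le_one hz0.le h1z h0.le
    have h5 : 0 < s ^ (1 - a) := by positivity
    have h6 : 0 < 1 / e := by positivity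
    nlinarith [mul_pos hE h6]
  · have h4 : z ^ a ≤ z := by
      have := Real.rpow_le_rpow_of_exponent_le h1z h1.le
      rwa [Real.rpow_one] at this
    have h5 : z * Real.exp (-z) ≤ 1 := by
      have := Real.add_one_le_exp z
      calc z * Real.exp (-z) ≤ Real.exp z * Real.exp (-z) := by gcongr; linarith
        _ = 1 := by rw [← Real.exp_add]; simp
    have h6 : Real.exp (Real.exp (-z) * (1 / e)) ≤
        1 + Real.exp (-z) * (1 / e) * Real.exp (1 / e) := by
      set r := Real.exp (-z) * (1 / e) with hr
      have hr1 : r ≤ 1 / e := mul_le_of_le_one_left (by positivity) hw1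
      have hr0 : 0 ≤ r := by positivity
      have h7 := Real.add_one_le_exp (-r)
      have h8 : Real.exp r * Real.exp (-r) = 1 := by rw [← Real.exp_add]; simp
      have h9 : Real.exp r ≤ Real.exp (1 / e) := Real.exp_le_exp.2 hr1
      nlinarith [mul_le_mul_of_nonneg_left h7 (Real.exp_pos r).le]
    calc s ^ (1 - a) * z ^ a ≤ (1 + Real.exp (-z) * (1 / e) * Real.exp (1 / e)) * z := by
          gcongr
          exact hsb.trans h6
      _ = z + (z * Real.exp (-z)) * ((1 / e) * Real.exp (1 / e)) := by ring
      _ ≤ z + 1 * ((1 / e) * Real.exp (1 / e)) := by gcongr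
      _ ≤ _ := by nlinarith

/-- A bound of the regularised symbol by the exact one, uniform in the order. -/
theorem regSymbol_le_mul_exp {e s0 L : ℝ} (he : 0 < e) (hs0 : 0 < s0) (hL : 0 < L) :
    ∃ C, 0 ≤ C ∧ ∀ a y x : ℝ, 1 / 2 ≤ a → a < 1 → 0 < y → y ≤ L → s0 ≤ √x →
      regSymbol a y x ≤ C * (√x ^ (1 + e) * Real.exp (√x * y)) := by
  obtain ⟨C, hC0, hC⟩ := mul_rpow_le_add he
  set K := Real.exp (C + 2 * ((1 + C) * s0 ^ (-e))) with hK
  have hK0 : 0 < K := Real.exp_pos _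
  refine ⟨s0 ^ (-(1 + e)) + (1 + L) + K * s0 ^ (-(1 + e)), by positivity,
    fun a y x h12 h1 hy hyL hx => ?_⟩
  set s := √x with hs
  have h0 : 0 < a := by linarith
  have hs' : 0 < s := hs0.trans_le hx
  have hsy : 0 < s * y := by positivity
  have hy' := rpow_le_max hy.le hyL h0.le h1.le
  -- The lower bound `s ≥ s0` absorbs constants into the right-hand side.
  have h1le : 1 ≤ s0 ^ (-(1 + e)) * (s ^ (1 + e) * Real.exp (s * y)) := by
    have h2 : s0 ^ (1 + e) ≤ s ^ (1 + e) := Real.rpow_le_rpow hs0.le hx (by linarith)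
    have h3 : 1 ≤ Real.exp (s * y) := Real.one_le_exp hsy.le
    calc (1 : ℝ) = s0 ^ (-(1 + e)) * (s0 ^ (1 + e) * 1) := by
          rw [mul_one, ← Real.rpow_add hs0]; simp
      _ ≤ _ := by gcongr
  have hse : 0 < s ^ (1 + e) * Real.exp (s * y) := by positivity
  -- If `1 - a` is above the threshold, `(1-a) Γ(1-a) = Γ(2-a) ≤ 1` controls `Γ(1-a)` in the linear
  -- bound. Below it, the exponent `s y^a / a` differs from `s y` by a bounded amount.
  rcases le_or_gt (Real.exp (-(s * y)) * s ^ (-e)) (1 - a) with h | h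
  · have hG : Real.Gamma (1 - a) ≤ Real.exp (s * y) * s ^ e := by
      have h2 := Gamma_le_one (x := 1 - a + 1) (by linarith) (by linarith)
      rw [Real.Gamma_add_one (by linarith)] at h2
      have hGp : 0 < Real.Gamma (1 - a) := Real.Gamma_pos_of_pos (by linarith)
      have h3 := mul_le_mul_of_nonneg_right h hGp.le
      have e1 : Real.exp (s * y) * s ^ e * (Real.exp (-(s * y)) * s ^ (-e)) = 1 := by
        rw [Real.rpow_neg hs'.le, Real.exp_neg]
        field_simp
      have h4 : 0 < Real.exp (s * y) * s ^ e := by positivity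
      calc Real.Gamma (1 - a) = Real.exp (s * y) * s ^ e *
            (Real.exp (-(s * y)) * s ^ (-e) * Real.Gamma (1 - a)) := by
              rw [← mul_assoc, e1, one_mul]
        _ ≤ Real.exp (s * y) * s ^ e * 1 := by gcongr; linarith
        _ = _ := mul_one _
    calc regSymbol a y x ≤ 1 + Real.Gamma (1 - a) * (s * y ^ a) := regSymbol_le h0 h1 hy.le
      _ ≤ 1 + Real.exp (s * y) * s ^ e * (s * (1 + L)) := by gcongr
      _ = 1 + (1 + L) * (s ^ (1 + e) * Real.exp (s * y)) := by
          rw [Real.rpow_add hs', Real.rpow_one]; ring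
      _ ≤ _ := by nlinarith [mul_pos (mul_pos hK0 (Real.rpow_pos_of_pos hs0 (-(1 + e)))) hse]
  · have hxle := hC a s y h0 h1 hs' hy h
    set w := s * y ^ a with hw
    have hw0 : 0 < w := by positivity
    have hz1 : s * y * Real.exp (-(s * y)) ≤ 1 := by
      have := Real.add_one_le_exp (s * y)
      calc s * y * Real.exp (-(s * y)) ≤ Real.exp (s * y) * Real.exp (-(s * y)) := by
            gcongr; linarith
        _ = 1 := by rw [← Real.exp_add]; simp
    have hexp1 : Real.exp (-(s * y)) ≤ 1 := Real.exp_le_one_iff.2 (by linarith)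
    have hse0 : s ^ (-e) ≤ s0 ^ (-e) := Real.rpow_le_rpow_of_nonpos hs0 hx (by linarith)
    have hwb : w * (1 - a) ≤ (1 + C) * s0 ^ (-e) := by
      calc w * (1 - a) ≤ (s * y + C) * (Real.exp (-(s * y)) * s ^ (-e)) := by gcongr
        _ = (s * y * Real.exp (-(s * y)) + C * Real.exp (-(s * y))) * s ^ (-e) := by ring
        _ ≤ (1 + C * 1) * s0 ^ (-e) := by gcongr
        _ = _ := by ring
    -- The division by `a` costs `w (1 - a) / a`, which is bounded because `a ≥ 1/2`.
    have hwa : w / a ≤ s * y + (C + 2 * ((1 + C) * s0 ^ (-e))) := by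
      have : w / a = w + w * (1 - a) / a := by field_simp; ring
      have h3 : w * (1 - a) / a ≤ 2 * (w * (1 - a)) := by
        rw [div_le_iff₀ h0]
        nlinarith [mul_nonneg hw0.le (show 0 ≤ 1 - a by linarith)]
      linarith
    calc regSymbol a y x ≤ Real.exp (w / a) := regSymbol_le_exp h0 h1 hy.le
      _ ≤ Real.exp (s * y + (C + 2 * ((1 + C) * s0 ^ (-e)))) := Real.exp_le_exp.2 hwa
      _ = K * Real.exp (s * y) * 1 := by rw [Real.exp_add, hK]; ring
      _ ≤ K * 1 * (s0 ^ (-(1 + e)) * (s ^ (1 + e) * Real.exp (s * y))) := by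
          have h2 : s0 ^ (1 + e) ≤ s ^ (1 + e) := Real.rpow_le_rpow hs0.le hx (by linarith)
          have h3 : 1 ≤ s0 ^ (-(1 + e)) * s ^ (1 + e) := by
            calc (1 : ℝ) = s0 ^ (-(1 + e)) * s0 ^ (1 + e) := by
                  rw [← Real.rpow_add hs0]; simp
              _ ≤ _ := by gcongr
          have h4 : 0 < K * Real.exp (s * y) := by positivity
          calc _ ≤ K * Real.exp (s * y) * (s0 ^ (-(1 + e)) * s ^ (1 + e)) := by gcongr
            _ = _ := by ring
      _ ≤ _ := by
          have : 0 < (s0 ^ (-(1 + e)) + (1 + L)) * (s ^ (1 + e) * Real.exp (s * y)) := by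
            positivity
          nlinarith

/-! ### Coefficients of spectral functions and the Landweber filter -/

section SpectralCalculus

variable {H : Type*} [NormedAddCommGroup H] [InnerProductSpace ℝ H]

theorem inner_basis_eq (φ : HilbertBasis ℕ ℝ H) (j k : ℕ) :
    inner ℝ (φ k) (φ j) = if k = j then (1 : ℝ) else 0 :=
  orthonormal_iff_ite.1 φ.orthonormal k j

/-- Dominated coefficients are square summable, so the isometry with `ℓ²` realises them as the
coordinates of a vector. -/
theorem summable_smul_of_abs_le (φ : HilbertBasis ℕ ℝ H) {c : ℕ → ℝ} {C : ℝ} {w : H}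
    (hc : ∀ j, |c j| ≤ C * |inner ℝ (φ j) w|) : Summable fun j => c j • φ j := by
  have hmem : Memℓp c 2 := by
    have h2 := (lp.memℓp (φ.repr w)).summable (by norm_num)
    refine memℓp_gen ((h2.mul_left (C ^ 2)).of_nonneg_of_le (fun j => by positivity) fun j => ?_)
    have := hc j
    simp only [ENNReal.toReal_ofNat, Real.rpow_ofNat, Real.norm_eq_abs, φ.repr_apply_apply]
    calc |c j| ^ 2 ≤ (C * |inner ℝ (φ j) w|) ^ 2 := by gcongr
      _ = _ := by ring
  exact (φ.hasSum_repr_symm ⟨c, hmem⟩).summable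

theorem InSpectralDomain.of_abs_le {φ : HilbertBasis ℕ ℝ H} {lam : ℕ → ℝ} {m : ℝ → ℝ} {w v : H}
    {C : ℝ} (h : ∀ j, |m (lam j) * inner ℝ (φ j) w| ≤ C * |inner ℝ (φ j) v|) :
    InSpectralDomain φ lam m w :=
  summable_smul_of_abs_le φ h

theorem InSpectralDomain.of_bounded {φ : HilbertBasis ℕ ℝ H} {lam : ℕ → ℝ} {m : ℝ → ℝ} {C : ℝ}
    (h : ∀ j, |m (lam j)| ≤ C) (w : H) : InSpectralDomain φ lam m w :=
  .of_abs_le (v := w) (C := C) fun j => by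
    rw [abs_mul]
    gcongr
    exact h j

theorem InSpectralDomain.inner_spectralMul {φ : HilbertBasis ℕ ℝ H} {lam : ℕ → ℝ} {m : ℝ → ℝ}
    {w : H} (h : InSpectralDomain φ lam m w) (k : ℕ) :
    inner ℝ (φ k) (spectralMul φ lam m w) = m (lam k) * inner ℝ (φ k) w := by
  have h1 := (innerSL ℝ (φ k)).hasSum h.hasSum
  refine h1.unique ?_
  convert hasSum_single k ?_ using 1
  · simp [φ.orthonormal.1 k]
  · intro j hj
    simp [inner_basis_eq, hj.symm]

theorem spectralMul_basis (φ : HilbertBasis ℕ ℝ H) (lam : ℕ → ℝ) (m : ℝ → ℝ) (k : ℕ) :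
    spectralMul φ lam m (φ k) = m (lam k) • φ k := by
  rw [spectralMul, tsum_eq_single k]
  · simp [φ.orthonormal.1 k]
  · intro j hj
    simp [inner_basis_eq, hj]

theorem tsum_ofReal_inner_sq (φ : HilbertBasis ℕ ℝ H) (w : H) :
    ∑' j, ENNReal.ofReal ((inner ℝ (φ j) w) ^ 2) = ENNReal.ofReal (‖w‖ ^ 2) := by
  have h := φ.hasSum_inner_mul_inner w w
  have e : ∀ j, inner ℝ w (φ j) * inner ℝ (φ j) w = (inner ℝ (φ j) w) ^ 2 := fun j => by
    rw [real_inner_comm, sq]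
  simp_rw [e, real_inner_self_eq_norm_sq] at h
  rw [← h.tsum_eq, ENNReal.ofReal_tsum_of_nonneg (fun j => sq_nonneg _) h.summable]

theorem eq_of_inner_basis_eq (φ : HilbertBasis ℕ ℝ H) {v w : H}
    (h : ∀ j, inner ℝ (φ j) v = inner ℝ (φ j) w) : v = w := by
  apply φ.repr.injective
  ext j
  rw [φ.repr_apply_apply, φ.repr_apply_apply, h]

theorem inner_smoothingOp {φ : HilbertBasis ℕ ℝ H} {lam : ℕ → ℝ} {μ τ : ℝ} {C : ℝ}
    (h : ∀ j, |μ * lam j ^ (-τ)| ≤ C) (w : H) (k : ℕ) :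
    inner ℝ (φ k) (smoothingOp φ lam μ τ w) = μ * lam k ^ (-τ) * inner ℝ (φ k) w :=
  (InSpectralDomain.of_bounded (m := fun x => μ * x ^ (-τ)) h w).inner_spectralMul k

/-- On each coefficient, with `a = μ λ^(-τ)`, a step is the affine map `c ↦ (1 - a) c + a b`,
started at 0. -/
theorem inner_landweber {φ : HilbertBasis ℕ ℝ H} {lam : ℕ → ℝ} {μ τ : ℝ} {C : ℝ}
    (h : ∀ j, |μ * lam j ^ (-τ)| ≤ C) (b : H) (k i : ℕ) :
    inner ℝ (φ k) (landweber (smoothingOp φ lam μ τ) b i)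
      = (1 - (1 - μ * lam k ^ (-τ)) ^ i) * inner ℝ (φ k) b := by
  induction i with
  | zero => simp [landweber]
  | succ i ih =>
    rw [landweber, inner_sub_right, inner_smoothingOp h, inner_sub_right, ih]
    ring

end SpectralCalculus

/-! ### The scalar Cauchy problem of a single mode -/

/-- Solutions of `v'' = s² v` on an interval, in terms of the initial values at its left end. -/
theorem cauchy_mode {s ℓ g : ℝ} (hs : 0 < s) (hℓ : 0 < ℓ) {v v' : ℝ → ℝ}
    (hv : ∀ y ∈ Ioo 0 ℓ, HasDerivAt v (v' y) y)
    (hv' : ∀ y ∈ Ioo 0 ℓ, HasDerivAt v' (s ^ 2 * v y) y)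
    (hg : HasDerivWithinAt v g (Ici 0) 0) {y : ℝ} (hy : y ∈ Ioo 0 ℓ) :
    v y = 1 / 2 * (v 0 + 1 / s * g) * Real.exp (s * y)
        + 1 / 2 * (v 0 - 1 / s * g) * Real.exp (-s * y) ∧
      1 / 2 * (v y + 1 / s * v' y) = 1 / 2 * (v 0 + 1 / s * g) * Real.exp (s * y) := by
  -- Factorisation of `∂² - s²`: for `r = ±s`, `v' + r v` solves a first-order equation, so `exp(-r
  -- y) (v' + r v)` is constant.
  have hc : ∀ r : ℝ, r ^ 2 = s ^ 2 → ∃ c, ∀ y ∈ Ioo 0 ℓ, v' y + r * v y = c * Real.exp (r * y) := by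
    intro r hr
    have hd : ∀ y ∈ Ioo 0 ℓ,
        HasDerivAt (fun y => Real.exp (-(r * y)) * (v' y + r * v y)) 0 y := by
      intro y hy
      have d1 := ((((hasDerivAt_id y).const_mul r).neg).exp).mul
        ((hv' y hy).add ((hv y hy).const_mul r))
      refine d1.congr_deriv ?_
      simp only [id, Pi.add_apply, Pi.neg_apply]
      rw [← hr]
      ring
    refine ⟨Real.exp (-(r * (ℓ / 2))) * (v' (ℓ / 2) + r * v (ℓ / 2)), fun y hy => ?_⟩
    have h := isOpen_Ioo.is_const_of_deriv_eq_zero isPreconnected_Ioo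
      (fun z hz => (hd z hz).differentiableAt.differentiableWithinAt)
      (fun z hz => (hd z hz).deriv) hy (show ℓ / 2 ∈ Ioo 0 ℓ by constructor <;> linarith)
    rw [← h, mul_right_comm, ← Real.exp_add]
    simp
  obtain ⟨c1, hc1⟩ := hc s rfl
  obtain ⟨c2, hc2⟩ := hc (-s) (by ring)
  have hform : ∀ y ∈ Ioo 0 ℓ,
      v y = 1 / (2 * s) * (c1 * Real.exp (s * y) - c2 * Real.exp (-s * y)) := by
    intro y hy
    have e1 := hc1 y hy
    have e2 := hc2 y hy
    rw [← e1, ← e2]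
    field_simp
    ring
  set F : ℝ → ℝ := fun y => 1 / (2 * s) * (c1 * Real.exp (s * y) - c2 * Real.exp (-s * y)) with hF
  have hFd : HasDerivAt F ((c1 + c2) / 2) 0 := by
    have d1 := (((hasDerivAt_id (0 : ℝ)).const_mul s).exp).const_mul c1
    have d2 := (((hasDerivAt_id (0 : ℝ)).const_mul (-s)).exp).const_mul c2
    refine ((d1.sub d2).const_mul (1 / (2 * s))).congr_deriv ?_
    simp
    field_simp
  -- The formula is known only for `y > 0`; the value and the one-sided derivative at 0 are matched
  -- by uniqueness of limits from the right.
  have hev : v =ᶠ[𝓝[>] 0] F := by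
    filter_upwards [Ioo_mem_nhdsGT hℓ] with y hy using hform y hy
  have h0 : v 0 = F 0 := by
    have l1 : Tendsto v (𝓝[>] 0) (𝓝 (v 0)) :=
      hg.continuousWithinAt.tendsto.mono_left (nhdsWithin_mono _ Ioi_subset_Ici_self)
    have l2 : Tendsto F (𝓝[>] 0) (𝓝 (F 0)) := hFd.continuousAt.tendsto.mono_left nhdsWithin_le_nhds
    exact tendsto_nhds_unique l1 (l2.congr' hev.symm)
  have hg' : g = (c1 + c2) / 2 := by
    have d1 : HasDerivWithinAt v g (Ioi 0) 0 := hg.mono Ioi_subset_Ici_self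
    have d2 : HasDerivWithinAt v ((c1 + c2) / 2) (Ioi 0) 0 :=
      (hFd.hasDerivWithinAt).congr_of_eventuallyEq hev h0
    exact (uniqueDiffWithinAt_Ioi 0).eq_deriv _ d1 d2
  have h0' : v 0 = 1 / (2 * s) * (c1 - c2) := by rw [h0, hF]; simp
  have ep : 1 / 2 * (v 0 + 1 / s * g) = c1 / (2 * s) := by
    rw [h0', hg']; field_simp; ring
  have eq : 1 / 2 * (v 0 - 1 / s * g) = -(c2 / (2 * s)) := by
    rw [h0', hg']; field_simp; ring
  rw [ep, eq]
  refine ⟨by rw [hform y hy]; ring, ?_⟩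
  have e1 := hc1 y hy
  calc 1 / 2 * (v y + 1 / s * v' y) = 1 / (2 * s) * (v' y + s * v y) := by field_simp; ring
    _ = _ := by rw [e1]; ring

/-! ### Poincaré's inequality and positivity of the eigenvalues -/

section Poincare

variable {d : ℕ}

theorem norm_gradient {ψ : EuclideanSpace ℝ (Fin d) → ℝ} (x : EuclideanSpace ℝ (Fin d)) :
    ‖gradient ψ x‖ = ‖fderiv ℝ ψ x‖ := by
  rw [gradient, LinearIsometryEquiv.norm_map]

/-- Poincare's inequality for test functions supported in a ball. -/
theorem poincare_integral (hd : 0 < d) {R : ℝ} {ψ : EuclideanSpace ℝ (Fin d) → ℝ}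
    (hψ : ContDiff ℝ ∞ ψ) (hc : HasCompactSupport ψ) (hR : ∀ x, ψ x ≠ 0 → ‖x‖ ≤ R) :
    ∫ x, ψ x ^ 2 ≤ 4 * R ^ 2 * ∫ x, ‖gradient ψ x‖ ^ 2 := by
  set i : Fin d := ⟨0, hd⟩
  set e : EuclideanSpace ℝ (Fin d) := EuclideanSpace.single i 1 with he
  have hen : ‖e‖ = 1 := by simp [he]
  have hψd : Differentiable ℝ ψ := hψ.differentiable (by simp)
  have hψc : Continuous ψ := hψ.continuous
  have hfc : Continuous (fderiv ℝ ψ) := hψ.continuous_fderiv (by simp)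
  have hfd : ∀ x, HasFDerivAt (fun x => ψ x ^ 2) ((2 * ψ x) • fderiv ℝ ψ x) x := by
    intro x
    refine ((hψd x).hasFDerivAt.pow 2).congr_fderiv ?_
    simp
  have hgd : ∀ x : EuclideanSpace ℝ (Fin d),
      HasFDerivAt (fun x : EuclideanSpace ℝ (Fin d) => x i)
        (EuclideanSpace.proj i : EuclideanSpace ℝ (Fin d) →L[ℝ] ℝ) x :=
    fun x => (EuclideanSpace.proj i : EuclideanSpace ℝ (Fin d) →L[ℝ] ℝ).hasFDerivAt
  have hcoord : Continuous fun x : EuclideanSpace ℝ (Fin d) => x i :=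
    (EuclideanSpace.proj i : EuclideanSpace ℝ (Fin d) →L[ℝ] ℝ).continuous
  have hzero : ∀ x, x ∉ tsupport ψ → ψ x = 0 := fun x hx => image_eq_zero_of_notMem_tsupport hx
  have hfzero : ∀ x, x ∉ tsupport ψ → fderiv ℝ ψ x = 0 := fun x hx =>
    image_eq_zero_of_notMem_tsupport fun h => hx (tsupport_fderiv_subset ℝ h)
  have hint : ∀ F : EuclideanSpace ℝ (Fin d) → ℝ, Continuous F →
      (∀ x, x ∉ tsupport ψ → F x = 0) → Integrable F := fun F hF h =>
    hF.integrable_of_hasCompactSupport (HasCompactSupport.intro hc h)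
  have h2 : Integrable fun x => ψ x ^ 2 :=
    hint _ (by fun_prop) fun x hx => by simp [hzero x hx]
  have h3 : Integrable fun x => ‖gradient ψ x‖ ^ 2 := by
    simp_rw [norm_gradient]
    exact hint _ (by fun_prop) fun x hx => by simp [hfzero x hx]
  have h4 : Integrable fun x => (2 * ψ x * fderiv ℝ ψ x e) * x i :=
    hint _ (by fun_prop) fun x hx => by simp [hzero x hx]
  -- Integration by parts of `ψ² · ∂ᵢ xᵢ`, where `∂ᵢ xᵢ = 1`.
  have key := integral_mul_fderiv_eq_neg_fderiv_mul_of_integrable (μ := volume) (𝕜 := ℝ)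
    (f := fun x => ψ x ^ 2) (g := fun x : EuclideanSpace ℝ (Fin d) => x i) (v := e)
    (by simpa [(hfd _).fderiv] using h4) (by simpa [(hgd _).fderiv, he] using h2)
    (hint _ (by fun_prop) fun x hx => by simp [hzero x hx])
    (fun x _ => (hfd x).differentiableAt) (fun x _ => (hgd x).differentiableAt)
  have hpe : (EuclideanSpace.proj i : EuclideanSpace ℝ (Fin d) →L[ℝ] ℝ) e = 1 := by simp [he]
  simp only [(hfd _).fderiv, (hgd _).fderiv, hpe, mul_one, ← integral_neg, smul_apply,
    smul_eq_mul] at key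
  -- Young's inequality with `|xᵢ| ≤ R` on the support; absorbing the half of `∫ ψ²` doubles `2 R²`
  -- to `4 R²`.
  have hle : ∫ x, ψ x ^ 2 ≤ ∫ x, (1 / 2 * ψ x ^ 2 + 2 * R ^ 2 * ‖gradient ψ x‖ ^ 2) := by
    rw [key]
    refine integral_mono h4.neg
      ((h2.const_mul _).add (h3.const_mul _)) fun x => ?_
    simp only
    rw [norm_gradient]
    by_cases hx : ψ x = 0
    · simp only [hx, mul_zero, zero_mul, neg_zero]
      positivity
    have hxi : |x i| ≤ R := (PiLp.norm_apply_le x i).trans (hR x hx)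
    have hfe : |fderiv ℝ ψ x e| ≤ ‖fderiv ℝ ψ x‖ := by
      simpa [hen] using (fderiv ℝ ψ x).le_opNorm e
    have hprod : |fderiv ℝ ψ x e * x i| ≤ ‖fderiv ℝ ψ x‖ * R := by
      rw [abs_mul]
      gcongr
    have hsq : (fderiv ℝ ψ x e * x i) ^ 2 ≤ (‖fderiv ℝ ψ x‖ * R) ^ 2 := by
      rw [← sq_abs]
      gcongr
    nlinarith [sq_nonneg (ψ x + 2 * (fderiv ℝ ψ x e * x i))]
  rw [integral_add (h2.const_mul _) (h3.const_mul _), integral_const_mul, integral_const_mul] at hle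
  linarith

theorem poincare_eLpNorm (hd : 0 < d) {R : ℝ} (hR0 : 0 ≤ R) {Ω : Set (EuclideanSpace ℝ (Fin d))}
    (hΩ : ∀ x ∈ Ω, ‖x‖ ≤ R) {ψ : EuclideanSpace ℝ (Fin d) → ℝ}
    (hψ : ContDiff ℝ ∞ ψ) (hc : HasCompactSupport ψ) (hs : tsupport ψ ⊆ Ω) :
    eLpNorm ψ 2 (volume.restrict Ω) ≤
      ENNReal.ofReal (2 * R) * eLpNorm (gradient ψ) 2 (volume.restrict Ω) := by
  have hfc : Continuous (fderiv ℝ ψ) := hψ.continuous_fderiv (by simp)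
  have hgc : Continuous (gradient ψ) := by
    unfold gradient
    fun_prop
  have hgz : ∀ x, x ∉ tsupport ψ → gradient ψ x = 0 := fun x hx => by
    rw [← norm_eq_zero, norm_gradient, norm_eq_zero]
    exact image_eq_zero_of_notMem_tsupport fun h => hx (tsupport_fderiv_subset ℝ h)
  have hgs : Function.support (gradient ψ) ⊆ Ω := fun x hx => by
    by_contra h
    exact hx (hgz x fun h' => h (hs h'))
  rw [eLpNorm_restrict_eq_of_support_subset ((subset_tsupport ψ).trans hs),
    eLpNorm_restrict_eq_of_support_subset hgs]
  have m1 : MemLp ψ 2 := hψ.continuous.memLp_of_hasCompactSupport hc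
  have m2 : MemLp (gradient ψ) 2 := hgc.memLp_of_hasCompactSupport (HasCompactSupport.intro hc hgz)
  have h := poincare_integral hd (R := R) hψ hc fun x hx => hΩ x (hs (subset_tsupport ψ hx))
  rw [m1.eLpNorm_eq_integral_rpow_norm (by norm_num) (by norm_num),
    m2.eLpNorm_eq_integral_rpow_norm (by norm_num) (by norm_num),
    ← ENNReal.ofReal_mul (by positivity)]
  refine ENNReal.ofReal_le_ofReal ?_
  simp only [ENNReal.toReal_ofNat, Real.rpow_ofNat, Real.norm_eq_abs, sq_abs]
  rw [← one_div, ← Real.sqrt_eq_rpow, ← Real.sqrt_eq_rpow]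
  calc √(∫ x, ψ x ^ 2) ≤ √((2 * R) ^ 2 * ∫ x, ‖gradient ψ x‖ ^ 2) :=
        Real.sqrt_le_sqrt (h.trans_eq (by ring))
    _ = _ := by rw [Real.sqrt_mul (by positivity), Real.sqrt_sq (by positivity)]

theorem HasH10Gradient.eq_zero_of_gradient_eq_zero (hd : 0 < d)
    {Ω : Set (EuclideanSpace ℝ (Fin d))} (hΩb : Bornology.IsBounded Ω) {v : L2 Ω}
    (h : HasH10Gradient Ω v 0) : v = 0 := by
  obtain ⟨R, hR0, hR⟩ := hΩb.exists_pos_norm_le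
  obtain ⟨ψ, hψ, hv, hg⟩ := h
  have hz : Tendsto (fun n => ENNReal.ofReal (2 * R) *
      eLpNorm (fun x => gradient (ψ n) x - (0 : L2Field Ω) x) 2 (volume.restrict Ω)
      + eLpNorm (fun x => ψ n x - v x) 2 (volume.restrict Ω)) atTop (𝓝 0) := by
    have := (ENNReal.Tendsto.const_mul (a := ENNReal.ofReal (2 * R)) hg
      (Or.inr ENNReal.ofReal_ne_top)).add hv
    rwa [mul_zero, zero_add] at this
  have hle : ∀ n, eLpNorm v 2 (volume.restrict Ω) ≤ ENNReal.ofReal (2 * R) *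
      eLpNorm (fun x => gradient (ψ n) x - (0 : L2Field Ω) x) 2 (volume.restrict Ω)
      + eLpNorm (fun x => ψ n x - v x) 2 (volume.restrict Ω) := by
    intro n
    obtain ⟨h1, h2, h3⟩ := hψ n
    have e1 : eLpNorm (fun x => gradient (ψ n) x - (0 : L2Field Ω) x) 2 (volume.restrict Ω)
        = eLpNorm (gradient (ψ n)) 2 (volume.restrict Ω) := by
      refine eLpNorm_congr_ae ?_
      filter_upwards [Lp.coeFn_zero (EuclideanSpace ℝ (Fin d)) 2 (volume.restrict Ω)] with x hx
      rw [hx, Pi.zero_apply, sub_zero]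
    have e2 : (v : EuclideanSpace ℝ (Fin d) → ℝ) = ψ n - fun x => ψ n x - v x := by
      ext x; simp
    rw [e1]
    have hm : AEStronglyMeasurable (ψ n) (volume.restrict Ω) :=
      h1.continuous.aestronglyMeasurable
    calc eLpNorm v 2 (volume.restrict Ω)
        = eLpNorm (ψ n - fun x => ψ n x - v x) 2 (volume.restrict Ω) := by rw [← e2]
      _ ≤ eLpNorm (ψ n) 2 (volume.restrict Ω)
          + eLpNorm (fun x => ψ n x - v x) 2 (volume.restrict Ω) :=
          eLpNorm_sub_le hm (hm.sub (Lp.aestronglyMeasurable v)) (by norm_num)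
      _ ≤ _ := by
          gcongr
          exact poincare_eLpNorm hd hR0.le hR h1 h2 h3
  have h0 : eLpNorm v 2 (volume.restrict Ω) = 0 :=
    le_antisymm (ge_of_tendsto' hz hle) (by simp)
  rw [eLpNorm_eq_zero_iff (Lp.aestronglyMeasurable v) (by norm_num)] at h0
  exact (Lp.eq_zero_iff_ae_eq_zero).2 h0

/-- Over a one-point space, any two elements of `L²` are proportional, so two orthonormal ones
cannot exist. A coordinate direction is needed for Poincaré's inequality. -/
theorem dimension_pos_of_hilbertBasis {Ω : Set (EuclideanSpace ℝ (Fin d))}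
    (φ : HilbertBasis ℕ ℝ (L2 Ω)) : 0 < d := by
  rcases Nat.eq_zero_or_pos d with rfl | h
  · exfalso
    have h : ∀ j k, inner ℝ (φ j) (φ k) = (volume.restrict Ω).real univ * (φ j 0 * φ k 0) := by
      intro j k
      have e : ∀ x, inner ℝ (φ j x) (φ k x) = φ j 0 * φ k 0 := fun x => by
        rw [Subsingleton.elim x 0]
        simp [mul_comm]
      simp_rw [L2.inner_def, e]
      rw [integral_const, smul_eq_mul]
    have h00 := h 0 0
    have h11 := h 1 1
    have h01 := h 0 1
    simp only [inner_basis_eq, if_true, zero_ne_one, if_false] at h00 h11 h01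
    have : (1 : ℝ) = 0 := by
      calc (1 : ℝ) = 1 * 1 := by ring
        _ = ((volume.restrict Ω).real univ * (φ 0 0 * φ 0 0)) *
            ((volume.restrict Ω).real univ * (φ 1 0 * φ 1 0)) := by rw [← h00, ← h11]
        _ = ((volume.restrict Ω).real univ * (φ 0 0 * φ 1 0)) ^ 2 := by ring
        _ = 0 := by rw [← h01]; ring
    exact one_ne_zero this
  · exact h

/-- Testing with `w` itself gives `‖∇w‖² = lam ‖w‖²`, and Poincaré's inequality excludes `∇w = 0`.
-/
theorem IsDirichletEigenfunction.eigenvalue_pos {Ω : Set (EuclideanSpace ℝ (Fin d))}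
    (hd : 0 < d) (hΩb : Bornology.IsBounded Ω) {lam : ℝ} {w : L2 Ω} (hw : w ≠ 0)
    (h : IsDirichletEigenfunction Ω lam w) : 0 < lam := by
  obtain ⟨G, hG, hGv⟩ := h
  have h1 := hGv w G hG
  rw [real_inner_self_eq_norm_sq, real_inner_self_eq_norm_sq] at h1
  have hw' : 0 < ‖w‖ ^ 2 := by
    have := norm_pos_iff.2 hw
    positivity
  have hG0 : 0 < ‖G‖ := by
    refine norm_pos_iff.2 fun h0 => hw ?_
    rw [h0] at hG
    exact hG.eq_zero_of_gradient_eq_zero hd hΩb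
  by_contra! hl
  have h2 : lam * ‖w‖ ^ 2 ≤ 0 := mul_nonpos_of_nonpos_of_nonneg hl hw'.le
  have h3 : 0 < ‖G‖ ^ 2 := by positivity
  linarith

end Poincare

/-! ### Bias and noise of the reconstruction -/

/-- Dominated convergence for series in `[0, ∞]`. -/
theorem tendsto_ennreal_tsum_zero {ι : Type*} {F : Filter ι} [F.IsCountablyGenerated]
    {f : ι → ℕ → ℝ≥0∞} {g : ℕ → ℝ≥0∞} (hg : ∑' j, g j ≠ ⊤) (hfg : ∀ᶠ i in F, ∀ j, f i j ≤ g j)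
    (hf : ∀ j, Tendsto (fun i => f i j) F (𝓝 0)) : Tendsto (fun i => ∑' j, f i j) F (𝓝 0) := by
  have h := tendsto_lintegral_filter_of_dominated_convergence (μ := Measure.count) (l := F)
    (F := f) (f := fun _ => 0) g (Eventually.of_forall fun i => measurable_of_countable _)
    (hfg.mono fun i hi => Eventually.of_forall hi) (by rwa [lintegral_count])
    (Eventually.of_forall hf)
  simpa [lintegral_count] using h

section Reconstruction

variable {H : Type*} [NormedAddCommGroup H] [InnerProductSpace ℝ H]

theorem sq_regSymbol_le {a y x Y : ℝ} (h0 : 0 < a) (h1 : a < 1) (hy : 0 ≤ y) (hyY : y ≤ Y)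
    (hx : 0 ≤ x) :
    regSymbol a y x ^ 2 ≤ 2 * (1 + Real.Gamma (1 - a) ^ 2 * (1 + Y) ^ 2 * x) := by
  have hG : 0 < Real.Gamma (1 - a) := Real.Gamma_pos_of_pos (by linarith)
  have h := regSymbol_le (x := x) h0 h1 hy
  have h2 := rpow_le_max hy hyY h0.le h1.le
  have h3 : regSymbol a y x ≤ 1 + Real.Gamma (1 - a) * (√x * (1 + Y)) := h.trans (by gcongr)
  have h4 := regSymbol_pos (x := x) h0 h1 hy
  calc regSymbol a y x ^ 2 ≤ (1 + Real.Gamma (1 - a) * (√x * (1 + Y))) ^ 2 := by gcongr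
    _ ≤ 2 * (1 + (Real.Gamma (1 - a) * (√x * (1 + Y))) ^ 2) := by
        nlinarith [sq_nonneg (1 - Real.Gamma (1 - a) * (√x * (1 + Y)))]
    _ = 2 * (1 + Real.Gamma (1 - a) ^ 2 * (1 + Y) ^ 2 * √x ^ 2) := by ring
    _ = _ := by rw [Real.sq_sqrt hx]

variable {φ : HilbertBasis ℕ ℝ H} {lam : ℕ → ℝ} {lam0 : ℝ}

/-- The symbol squared grows at most linearly in `λ`, and `λ Xⱼ²` is bounded because `λ^(σ+1) Xⱼ²`
is and `λ ≥ lam0`. -/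
theorem inSpectralDomain_regSymbol (hlam0 : 0 < lam0) (hlam : ∀ j, lam0 ≤ lam j) {σ : ℝ}
    (hσ : 0 ≤ σ) {a y κ : ℝ} (h0 : 0 < a) (h1 : a < 1) (hy : 0 ≤ y) {X : ℕ → ℝ} {w b : H}
    (hw : ∀ j, inner ℝ (φ j) w = X j * inner ℝ (φ j) b)
    (hX0 : ∀ j, 0 ≤ X j) (hX1 : ∀ j, X j ≤ 1) (hXκ : ∀ j, lam j ^ (σ + 1) * X j ^ 2 ≤ κ) :
    InSpectralDomain φ lam (regSymbol a y) w := by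
  refine .of_abs_le (v := b)
    (C := √(2 * (1 + Real.Gamma (1 - a) ^ 2 * (1 + y) ^ 2 * (lam0 ^ (-σ) * κ)))) fun j => ?_
  rw [hw, ← mul_assoc, abs_mul]
  refine mul_le_mul_of_nonneg_right (Real.abs_le_sqrt ?_) (abs_nonneg _)
  have hlj : 0 < lam j := hlam0.trans_le (hlam j)
  have hR := sq_regSymbol_le h0 h1 hy le_rfl hlj.le
  have hlX : lam j * X j ^ 2 ≤ lam0 ^ (-σ) * κ := by
    have e : lam0 ^ σ ≤ lam j ^ σ := Real.rpow_le_rpow hlam0.le (hlam j) hσ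
    calc lam j * X j ^ 2 = lam0 ^ (-σ) * (lam j * lam0 ^ σ * X j ^ 2) := by
          rw [Real.rpow_neg hlam0.le]
          field_simp
      _ ≤ lam0 ^ (-σ) * (lam j * lam j ^ σ * X j ^ 2) := by gcongr
      _ = lam0 ^ (-σ) * (lam j ^ (σ + 1) * X j ^ 2) := by
          rw [Real.rpow_add hlj, Real.rpow_one]; ring
      _ ≤ _ := by gcongr; exact hXκ j
  have hX2 : X j ^ 2 ≤ 1 := pow_le_one₀ (hX0 j) (hX1 j)
  calc (regSymbol a y (lam j) * X j) ^ 2 = regSymbol a y (lam j) ^ 2 * X j ^ 2 := by ring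
    _ ≤ 2 * (1 + Real.Gamma (1 - a) ^ 2 * (1 + y) ^ 2 * lam j) * X j ^ 2 := by gcongr
    _ = 2 * (X j ^ 2 + Real.Gamma (1 - a) ^ 2 * (1 + y) ^ 2 * (lam j * X j ^ 2)) := by ring
    _ ≤ _ := by gcongr

theorem inSpectralDomain_exp {y : ℝ} (hy : 0 ≤ y) (q : H) :
    InSpectralDomain φ lam (fun x => Real.exp (-√x * y)) q :=
  .of_bounded (C := 1) (fun j => by
    rw [abs_of_pos (Real.exp_pos _), Real.exp_le_one_iff, neg_mul]
    have := mul_nonneg (Real.sqrt_nonneg (lam j)) hy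
    linarith) q

/-- The contribution of the data noise to the squared `H^σ` error. -/
theorem noise_term_le (hlam0 : 0 < lam0) {σ x X κ a y Y c : ℝ} (hx : lam0 ≤ x)
    (h0 : 0 < a) (h1 : a < 1) (hy : 0 ≤ y) (hyY : y ≤ Y) (hXκ : x ^ (σ + 1) * X ^ 2 ≤ κ) :
    x ^ σ * (X * c * regSymbol a y x) ^ 2 ≤
      2 * (4 / lam0 + (1 + Y) ^ 2) * (Real.Gamma (1 - a) ^ 2 * κ) * c ^ 2 := by
  have hx0 : 0 < x := hlam0.trans_le hx
  have hR := sq_regSymbol_le h0 h1 hy hyY hx0.le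
  -- `Γ(1-a) ≥ 1/2` lets `Γ(1-a)²` absorb the constant part of the symbol bound too.
  have hG : 1 ≤ 4 * Real.Gamma (1 - a) ^ 2 := by
    have h2 := half_le_Gamma (x := 1 - a + 1) (by linarith)
    have hGp : 0 < Real.Gamma (1 - a) := Real.Gamma_pos_of_pos (by linarith)
    rw [Real.Gamma_add_one (by linarith)] at h2
    have : 1 / 2 ≤ Real.Gamma (1 - a) := by nlinarith
    nlinarith
  have hκ0 : 0 ≤ κ := le_trans (by positivity) hXκ
  have e1 : x ^ (σ + 1) = x ^ σ * x := by rw [Real.rpow_add hx0, Real.rpow_one]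
  have e2 : x ^ σ * X ^ 2 ≤ κ / lam0 := by
    rw [le_div_iff₀ hlam0]
    calc x ^ σ * X ^ 2 * lam0 ≤ x ^ σ * X ^ 2 * x := by gcongr
      _ = x ^ (σ + 1) * X ^ 2 := by rw [e1]; ring
      _ ≤ κ := hXκ
  calc x ^ σ * (X * c * regSymbol a y x) ^ 2 = x ^ σ * X ^ 2 * c ^ 2 * regSymbol a y x ^ 2 := by
        ring
    _ ≤ x ^ σ * X ^ 2 * c ^ 2 * (2 * (1 + Real.Gamma (1 - a) ^ 2 * (1 + Y) ^ 2 * x)) := by gcongr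
    _ = 2 * (x ^ σ * X ^ 2 + Real.Gamma (1 - a) ^ 2 * (1 + Y) ^ 2 * (x ^ (σ + 1) * X ^ 2)) *
          c ^ 2 := by rw [e1]; ring
    _ ≤ 2 * (1 * (κ / lam0) + Real.Gamma (1 - a) ^ 2 * (1 + Y) ^ 2 * κ) * c ^ 2 := by
        rw [one_mul]; gcongr
    _ ≤ 2 * (4 * Real.Gamma (1 - a) ^ 2 * (κ / lam0) + Real.Gamma (1 - a) ^ 2 * (1 + Y) ^ 2 * κ) *
          c ^ 2 := by gcongr
    _ = _ := by ring

/-- The contribution of the exact data to the squared `H^σ` error vanishes in the limit. -/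
theorem tendsto_bias (hlam0 : 0 < lam0) (hlam : ∀ j, lam0 ≤ lam j) {ℓ σ e : ℝ}
    (hℓ : 0 < ℓ) (he : 0 < e) {p : ℕ → ℝ}
    (hreg : ∫⁻ y in Ioo 0 ℓ, ∑' j, ENNReal.ofReal (lam j ^ (σ + 1 + e) *
      (p j * Real.exp (√(lam j) * y)) ^ 2) ≠ ⊤)
    {F : Filter ℝ} [F.IsCountablyGenerated] {a : ℝ → ℝ} {X : ℝ → ℕ → ℝ}
    (ha : ∀ᶠ δ in F, a δ ∈ Ioo 0 1) (ha1 : Tendsto a F (𝓝 1))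
    (hX0 : ∀ δ j, 0 ≤ X δ j) (hX1 : ∀ δ j, X δ j ≤ 1)
    (hXlim : ∀ j, Tendsto (fun δ => X δ j) F (𝓝 1)) :
    Tendsto (fun δ => ∫⁻ y in Ioo 0 ℓ, ∑' j, ENNReal.ofReal (lam j ^ σ *
      (p j * (Real.exp (√(lam j) * y) - X δ j * regSymbol (a δ) y (lam j))) ^ 2)) F (𝓝 0) := by
  obtain ⟨C, hC0, hC⟩ := regSymbol_le_mul_exp he (Real.sqrt_pos.2 hlam0) hℓ
  -- The first summand dominates the exact symbol, the second the regularised one.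
  set K := √lam0 ^ (-(1 + e)) + C with hK
  have hlpos : ∀ j, 0 < lam j := fun j => hlam0.trans_le (hlam j)
  have hsl : ∀ j, √lam0 ≤ √(lam j) := fun j => Real.sqrt_le_sqrt (hlam j)
  have hs0 : 0 < √lam0 := Real.sqrt_pos.2 hlam0
  set f : ℝ → ℝ → ℕ → ℝ≥0∞ := fun δ y j => ENNReal.ofReal (lam j ^ σ *
    (p j * (Real.exp (√(lam j) * y) - X δ j * regSymbol (a δ) y (lam j))) ^ 2) with hf
  set g : ℝ → ℕ → ℝ≥0∞ := fun y j => ENNReal.ofReal (K ^ 2) * ENNReal.ofReal (lam j ^ (σ + 1 + e) *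
      (p j * Real.exp (√(lam j) * y)) ^ 2) with hg
  have hgm : Measurable fun y => ∑' j, g y j := Measurable.tsum fun j => by
    simp only [hg]; fun_prop
  have hgfin : ∫⁻ y in Ioo 0 ℓ, ∑' j, g y j ≠ ⊤ := by
    simp only [hg, ENNReal.tsum_mul_left]
    rw [lintegral_const_mul' _ _ ENNReal.ofReal_ne_top]
    exact ENNReal.mul_ne_top ENNReal.ofReal_ne_top hreg
  have hdom : ∀ᶠ δ in F, ∀ y ∈ Ioo 0 ℓ, ∀ j, f δ y j ≤ g y j := by
    filter_upwards [ha, ha1.eventually_const_lt (show (1 / 2 : ℝ) < 1 by norm_num)]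
      with δ h1 h2 y hy j
    simp only [hf, hg]
    rw [← ENNReal.ofReal_mul (sq_nonneg _)]
    refine ENNReal.ofReal_le_ofReal ?_
    set s := √(lam j) with hs
    have hspos : 0 < s := hs0.trans_le (hsl j)
    have hR := hC (a δ) y (lam j) h2.le h1.2 hy.1 hy.2.le (hsl j)
    have hR0 := regSymbol_pos (x := lam j) h1.1 h1.2 hy.1.le
    have hE := Real.exp_pos (s * y)
    have h3 : 1 ≤ √lam0 ^ (-(1 + e)) * s ^ (1 + e) := by
      calc (1 : ℝ) = √lam0 ^ (-(1 + e)) * √lam0 ^ (1 + e) := by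
            rw [← Real.rpow_add hs0]; simp
        _ ≤ _ := by
            gcongr
            exact hsl j
    have habs : |Real.exp (s * y) - X δ j * regSymbol (a δ) y (lam j)| ≤
        K * (s ^ (1 + e) * Real.exp (s * y)) := by
      have hXR : X δ j * regSymbol (a δ) y (lam j) ≤ C * (s ^ (1 + e) * Real.exp (s * y)) :=
        (mul_le_of_le_one_left hR0.le (hX1 δ j)).trans hR
      have hXR0 : 0 ≤ X δ j * regSymbol (a δ) y (lam j) := mul_nonneg (hX0 δ j) hR0.le
      have hE1 : Real.exp (s * y) ≤ √lam0 ^ (-(1 + e)) * (s ^ (1 + e) * Real.exp (s * y)) := by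
        rw [← mul_assoc]
        exact le_mul_of_one_le_left hE.le h3
      have hnn : 0 ≤ √lam0 ^ (-(1 + e)) * (s ^ (1 + e) * Real.exp (s * y)) := by positivity
      have hnn2 : 0 ≤ C * (s ^ (1 + e) * Real.exp (s * y)) := by positivity
      rw [hK, add_mul, abs_le]
      constructor <;> linarith
    have hse : (s ^ (1 + e)) ^ 2 = lam j ^ (1 + e) := by
      rw [← Real.rpow_mul_natCast hspos.le, mul_comm, Real.rpow_mul hspos.le]
      simp [hs, Real.sq_sqrt (hlpos j).le]
    have hl := hlpos j
    calc lam j ^ σ * (p j * (Real.exp (s * y) - X δ j * regSymbol (a δ) y (lam j))) ^ 2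
        = lam j ^ σ * p j ^ 2 *
          |Real.exp (s * y) - X δ j * regSymbol (a δ) y (lam j)| ^ 2 := by
            rw [sq_abs]; ring
      _ ≤ lam j ^ σ * p j ^ 2 * (K * (s ^ (1 + e) * Real.exp (s * y))) ^ 2 := by gcongr
      _ = K ^ 2 * (lam j ^ σ * (s ^ (1 + e)) ^ 2 * (p j * Real.exp (s * y)) ^ 2) := by ring
      _ = _ := by
          rw [hse, ← Real.rpow_add hl, add_assoc σ 1 e]
  have hlim : ∀ y ∈ Ioo 0 ℓ, ∀ j, Tendsto (fun δ => f δ y j) F (𝓝 0) := by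
    intro y hy j
    have h := (hXlim j).mul (tendsto_regSymbol ha1 (lam j) hy.1)
    have h2 := (((h.const_sub (Real.exp (√(lam j) * y))).const_mul (p j)).pow 2).const_mul
      (lam j ^ σ)
    simpa [hf] using ENNReal.tendsto_ofReal h2
  -- Dominated convergence is applied in `y`; its pointwise hypothesis is dominated convergence in
  -- `j`, valid where the majorant series is finite.
  have h := tendsto_lintegral_filter_of_dominated_convergence
    (μ := volume.restrict (Ioo 0 ℓ)) (l := F) (F := fun δ y => ∑' j, f δ y j) (f := fun _ => 0)
    (fun y => ∑' j, g y j) ?_ ?_ hgfin ?_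
  · simpa using h
  · filter_upwards [ha] with δ h1
    refine Measurable.tsum fun j => ?_
    have := measurable_regSymbol h1.1 h1.2.le (lam j)
    simp only [hf]
    fun_prop
  · filter_upwards [hdom] with δ h1
    refine (ae_restrict_iff' measurableSet_Ioo).2 (Eventually.of_forall fun y hy => ?_)
    exact ENNReal.tsum_le_tsum (h1 y hy)
  · filter_upwards [ae_lt_top hgm hgfin, ae_restrict_mem measurableSet_Ioo] with y h1 hy
    exact tendsto_ennreal_tsum_zero h1.ne (hdom.mono fun δ h => h y hy) (hlim y hy)

/-- Convergence of the fractionally regularised reconstruction, for smoothed data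
`⟨φⱼ, w⟩ = Xⱼ ⟨φⱼ, b⟩`, in terms of the exact modes. -/
theorem tendsto_reconstruction (hlam0 : 0 < lam0) (hlam : ∀ j, lam0 ≤ lam j) {ℓ σ e : ℝ}
    (hℓ : 0 < ℓ) (hσ : 0 ≤ σ) (he : 0 < e) {P Q : H} {u : ℝ → H}
    (hu : ∀ y ∈ Ioo 0 ℓ, ∀ j, inner ℝ (φ j) (u y) = inner ℝ (φ j) P * Real.exp (√(lam j) * y)
      + inner ℝ (φ j) Q * Real.exp (-√(lam j) * y))
    (hreg : ∫⁻ y in Ioo 0 ℓ, ∑' j, ENNReal.ofReal (lam j ^ (σ + 1 + e) *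
      (inner ℝ (φ j) P * Real.exp (√(lam j) * y)) ^ 2) ≠ ⊤)
    {a : ℝ → ℝ} {X : ℝ → ℕ → ℝ} {κ : ℝ → ℝ} {w b : ℝ → H}
    (ha : ∀ᶠ δ in 𝓝[>] 0, a δ ∈ Ioo 0 1) (ha1 : Tendsto a (𝓝[>] 0) (𝓝 1))
    (hb : ∀ δ, 0 < δ → ‖b δ - P‖ ≤ δ)
    (hw : ∀ δ j, inner ℝ (φ j) (w δ) = X δ j * inner ℝ (φ j) (b δ))
    (hX0 : ∀ δ j, 0 ≤ X δ j) (hX1 : ∀ δ j, X δ j ≤ 1)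
    (hXκ : ∀ δ j, lam j ^ (σ + 1) * X δ j ^ 2 ≤ κ δ)
    (hXlim : ∀ j, Tendsto (fun δ => X δ j) (𝓝[>] 0) (𝓝 1))
    (hrate : Tendsto (fun δ => Real.Gamma (1 - a δ) ^ 2 * κ δ * δ ^ 2) (𝓝[>] 0) (𝓝 0)) :
    Tendsto (fun δ => normL2Sobolev φ lam ℓ σ
      (fun y => u y - reconstruction φ lam (a δ) (w δ) Q y)) (𝓝[>] 0) (𝓝 0) := by
  set K := 2 * (4 / lam0 + (1 + ℓ) ^ 2) with hK
  have hbias := tendsto_bias hlam0 hlam hℓ he hreg ha ha1 hX0 hX1 hXlim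
  set T : ℝ → ℝ≥0∞ := fun δ => ∫⁻ y in Ioo 0 ℓ, ∑' j, ENNReal.ofReal (lam j ^ σ *
      (inner ℝ (φ j) P * (Real.exp (√(lam j) * y) - X δ j * regSymbol (a δ) y (lam j))) ^ 2)
  set N : ℝ → ℝ≥0∞ := fun δ =>
    ENNReal.ofReal (2 * (K * (Real.Gamma (1 - a δ) ^ 2 * κ δ * δ ^ 2))) * volume (Ioo 0 ℓ) with hN
  have hNlim : Tendsto N (𝓝[>] 0) (𝓝 0) := by
    have h1 := ENNReal.tendsto_ofReal ((hrate.const_mul K).const_mul 2)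
    have h2 := ENNReal.Tendsto.mul_const (b := volume (Ioo 0 ℓ)) h1 (Or.inr (by simp))
    rwa [mul_zero, mul_zero, ENNReal.ofReal_zero, zero_mul] at h2
  have hlim : Tendsto (fun δ => (2 * T δ + N δ) ^ (1 / 2 : ℝ)) (𝓝[>] 0) (𝓝 0) := by
    have h1 := (ENNReal.Tendsto.const_mul (a := 2) hbias (Or.inr (by simp))).add hNlim
    rw [mul_zero, zero_add] at h1
    have h2 := h1.ennrpow_const (1 / 2 : ℝ)
    simpa using h2
  refine tendsto_of_tendsto_of_tendsto_of_le_of_le' tendsto_const_nhds hlim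
    (Eventually.of_forall fun δ => zero_le) ?_
  filter_upwards [ha, self_mem_nhdsWithin] with δ h1 hδ
  have hδ0 : 0 < δ := hδ
  refine ENNReal.rpow_le_rpow ?_ (by norm_num)
  have hpt : ∀ y ∈ Ioo 0 ℓ, sobolevSq φ lam σ (u y - reconstruction φ lam (a δ) (w δ) Q y) ≤
      2 * (∑' j, ENNReal.ofReal (lam j ^ σ *
      (inner ℝ (φ j) P * (Real.exp (√(lam j) * y) - X δ j * regSymbol (a δ) y (lam j))) ^ 2)) +
      ENNReal.ofReal (2 * (K * (Real.Gamma (1 - a δ) ^ 2 * κ δ * δ ^ 2))) := by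
    intro y hy
    have hdom := inSpectralDomain_regSymbol (φ := φ) hlam0 hlam hσ h1.1 h1.2 hy.1.le
      (hw δ) (hX0 δ) (hX1 δ) (hXκ δ)
    -- The stable parts cancel; what remains is bias minus noise.
    have hcoef : ∀ j, inner ℝ (φ j) (u y - reconstruction φ lam (a δ) (w δ) Q y) =
        inner ℝ (φ j) P * (Real.exp (√(lam j) * y) - X δ j * regSymbol (a δ) y (lam j))
        - X δ j * inner ℝ (φ j) (b δ - P) * regSymbol (a δ) y (lam j) := by
      intro j
      rw [inner_sub_right, hu y hy, reconstruction, inner_add_right, hdom.inner_spectralMul,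
        (inSpectralDomain_exp hy.1.le Q).inner_spectralMul, hw, inner_sub_right]
      ring
    have hκ0 : 0 ≤ κ δ := by
      refine le_trans ?_ (hXκ δ 0)
      have := hlam0.trans_le (hlam 0)
      positivity
    have hKG : 0 ≤ K * (Real.Gamma (1 - a δ) ^ 2 * κ δ) := by positivity
    have hterm : ∀ j, ENNReal.ofReal (lam j ^ σ *
        (inner ℝ (φ j) (u y - reconstruction φ lam (a δ) (w δ) Q y)) ^ 2) ≤
        2 * ENNReal.ofReal (lam j ^ σ * (inner ℝ (φ j) P *
          (Real.exp (√(lam j) * y) - X δ j * regSymbol (a δ) y (lam j))) ^ 2) +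
        ENNReal.ofReal (2 * (K * (Real.Gamma (1 - a δ) ^ 2 * κ δ))) *
          ENNReal.ofReal ((inner ℝ (φ j) (b δ - P)) ^ 2) := by
      intro j
      have hl := hlam0.trans_le (hlam j)
      have hn := noise_term_le (c := inner ℝ (φ j) (b δ - P)) hlam0 (hlam j) h1.1 h1.2 hy.1.le
        hy.2.le (hXκ δ j)
      rw [hcoef, ← ENNReal.ofReal_mul (by positivity),
        show (2 : ℝ≥0∞) = ENNReal.ofReal 2 by simp, ← ENNReal.ofReal_mul (by norm_num),
        ← ENNReal.ofReal_add (by positivity) (by positivity)]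
      refine ENNReal.ofReal_le_ofReal ?_
      set A := inner ℝ (φ j) P * (Real.exp (√(lam j) * y) - X δ j * regSymbol (a δ) y (lam j))
      set B := X δ j * inner ℝ (φ j) (b δ - P) * regSymbol (a δ) y (lam j)
      have hls : 0 < lam j ^ σ := by positivity
      have h5 : (A - B) ^ 2 ≤ 2 * A ^ 2 + 2 * B ^ 2 := by nlinarith [sq_nonneg (A + B)]
      calc lam j ^ σ * (A - B) ^ 2 ≤ lam j ^ σ * (2 * A ^ 2 + 2 * B ^ 2) := by gcongr
        _ = 2 * (lam j ^ σ * A ^ 2) + 2 * (lam j ^ σ * B ^ 2) := by ring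
        _ ≤ 2 * (lam j ^ σ * A ^ 2) + 2 * (2 * (4 / lam0 + (1 + ℓ) ^ 2) *
            (Real.Gamma (1 - a δ) ^ 2 * κ δ) * inner ℝ (φ j) (b δ - P) ^ 2) := by gcongr
        _ = _ := by rw [hK]; ring
    refine (ENNReal.tsum_le_tsum hterm).trans ?_
    rw [ENNReal.tsum_add, ENNReal.tsum_mul_left, ENNReal.tsum_mul_left, tsum_ofReal_inner_sq,
      ← ENNReal.ofReal_mul (by positivity)]
    refine add_le_add le_rfl (ENNReal.ofReal_le_ofReal ?_)
    have h6 : ‖b δ - P‖ ^ 2 ≤ δ ^ 2 := by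
      gcongr
      exact hb δ hδ0
    calc 2 * (K * (Real.Gamma (1 - a δ) ^ 2 * κ δ)) * ‖b δ - P‖ ^ 2
        ≤ 2 * (K * (Real.Gamma (1 - a δ) ^ 2 * κ δ)) * δ ^ 2 := by gcongr
      _ = _ := by ring
  calc ∫⁻ y in Ioo 0 ℓ, sobolevSq φ lam σ (u y - reconstruction φ lam (a δ) (w δ) Q y)
      ≤ _ := setLIntegral_mono' measurableSet_Ioo hpt
    _ = 2 * T δ + N δ := by
        rw [lintegral_add_right _ measurable_const, lintegral_const_mul' _ _ (by simp),
          setLIntegral_const]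

end Reconstruction

/-! ### Modes of the solution and choice of parameters -/

/-- For a weight in `[0, 1]` the square is at most the weight, which Bernoulli's inequality bounds
by `i a`. The squared filter thus costs a single factor `i`, matching the square root of the
logarithm in `δ̃`. -/
theorem smoothing_weight_le {a : ℝ} (h0 : 0 ≤ a) (h1 : a ≤ 1) (i : ℕ) :
    0 ≤ 1 - (1 - a) ^ i ∧ 1 - (1 - a) ^ i ≤ 1 ∧ (1 - (1 - a) ^ i) ^ 2 ≤ i * a := by
  have h2 : (1 - a) ^ i ≤ 1 := pow_le_one₀ (by linarith) (by linarith)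
  have h3 : 0 ≤ (1 - a) ^ i := pow_nonneg (by linarith) i
  have h4 := one_add_mul_le_pow (show -2 ≤ -a by linarith) i
  rw [← sub_eq_add_neg] at h4
  refine ⟨by linarith, by linarith, ?_⟩
  nlinarith

/-- The modes of a solution of the Cauchy problem. -/
theorem IsCauchySolution.inner_eq {d : ℕ} {Ω : Set (EuclideanSpace ℝ (Fin d))}
    {φ : HilbertBasis ℕ ℝ (L2 Ω)} {lam : ℕ → ℝ} {lam0 : ℝ}
    (hφ : ∀ j, IsDirichletEigenfunction Ω (lam j) (φ j)) (hlam0 : 0 < lam0)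
    (hlam : ∀ j, lam0 ≤ lam j) {ℓ : ℝ} {f g : L2 Ω} {u : ℝ → L2 Ω}
    (hu : IsCauchySolution Ω ℓ f g u) {y : ℝ} (hy : y ∈ Ioo 0 ℓ) (j : ℕ) :
    inner ℝ (φ j) (u y) = inner ℝ (φ j) (plusData φ lam f g) * Real.exp (√(lam j) * y)
        + inner ℝ (φ j) (minusData φ lam f g) * Real.exp (-√(lam j) * y) ∧
      inner ℝ (φ j) (plusPart φ lam u y)
        = inner ℝ (φ j) (plusData φ lam f g) * Real.exp (√(lam j) * y) := by
  obtain ⟨Gj, hGj, hj⟩ := hφ j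
  have hl : 0 < lam j := hlam0.trans_le (hlam j)
  have hinv : ∀ w : L2 Ω, inner ℝ (φ j) (invSqrt φ lam w) = 1 / √(lam j) * inner ℝ (φ j) w := by
    intro w
    refine (InSpectralDomain.of_bounded (C := 1 / √lam0) (fun k => ?_) w).inner_spectralMul j
    have h1 : 0 < √lam0 := Real.sqrt_pos.2 hlam0
    rw [abs_of_nonneg (by positivity)]
    exact one_div_le_one_div_of_le h1 (Real.sqrt_le_sqrt (hlam k))
  have hv : ∀ y ∈ Ioo 0 ℓ, HasDerivAt (fun z => inner ℝ (φ j) (u z))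
      (inner ℝ (φ j) (deriv u y)) y := fun y hy =>
    (innerSL ℝ (φ j)).hasFDerivAt.comp_hasDerivAt y (hu.differentiableAt y hy).hasDerivAt
  have hv' : ∀ y ∈ Ioo 0 ℓ, HasDerivAt (fun z => inner ℝ (φ j) (deriv u z))
      (√(lam j) ^ 2 * inner ℝ (φ j) (u y)) y := by
    intro y hy
    obtain ⟨G, hG, h⟩ := hu.equation y hy
    -- The equation tested with `φⱼ` meets the eigenvalue relation tested with `u(y)`.
    have h1 := h (φ j) Gj hGj
    rw [real_inner_comm, hj (u y) G hG] at h1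
    rw [Real.sq_sqrt hl.le]
    simpa only [real_inner_comm] using h1
  have hg : HasDerivWithinAt (fun z => inner ℝ (φ j) (u z)) (inner ℝ (φ j) g) (Ici 0) 0 := by
    simpa only [real_inner_comm] using hu.initial_deriv (φ j) Gj hGj
  have h := cauchy_mode (Real.sqrt_pos.2 hl) (hy.1.trans hy.2) hv hv' hg hy
  simp only [hu.initial_value] at h
  rw [plusData, minusData, plusPart]
  simp only [inner_smul_right, inner_add_right, inner_sub_right, hinv]
  exact h

theorem mainTheorem1 {d : ℕ} (Ω : Set (EuclideanSpace ℝ (Fin d)))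
    (hΩo : IsOpen Ω) (hΩb : Bornology.IsBounded Ω)
    -- an orthonormal basis of Dirichlet eigenfunctions of `-Δₓ` with its eigenvalues
    (φ : HilbertBasis ℕ ℝ (L2 Ω)) (lam : ℕ → ℝ)
    (hφ : ∀ j, IsDirichletEigenfunction Ω (lam j) (φ j))
    -- the exact solution and its regularity
    (ℓ : ℝ) (f g : L2 Ω) (u : ℝ → L2 Ω) (hu : IsCauchySolution Ω ℓ f g u)
    (σ p : ℝ) (hσ : 0 ≤ σ) (hp : 1 < p)
    (hreg : normL2Sobolev φ lam ℓ (σ + 1 + 1 / p) (plusPart φ lam u) < ⊤)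
    -- the noisy data, for every noise level `δ > 0`
    (fδ gδ : ℝ → L2 Ω)
    (hnoise : ∀ δ, 0 < δ → ‖plusData φ lam (fδ δ) (gδ δ) - plusData φ lam f g‖ ≤ δ)
    -- smoothing by Landweber iteration
    (μ : ℝ) (hμ : 0 < μ) (hA : ∀ w : L2 Ω, ‖smoothingOp φ lam μ (σ + 1) w‖ ≤ ‖w‖)
    (l : ℝ) (hl : l ∈ Ioo 0 ℓ)
    (iStar : ℝ → ℕ)
    (hiStar : (fun δ => (iStar δ : ℝ)) =Θ[𝓝[>] 0]
      fun δ => (l ^ 2)⁻¹ * Real.log (‖plusPart φ lam u l‖ / δ))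
    -- choice of the fractional order in dependence of the smoothed noise level
    (C₂ : ℝ) (hC₂ : 0 < C₂)
    (α : ℝ → ℝ) (hα : ∀ t, 0 < t → α t ∈ Ioo 0 1)
    (hα1 : Tendsto (fun δ => α (smoothedLevel C₂ l ‖plusPart φ lam u l‖ δ)) (𝓝[>] 0) (𝓝 1))
    (hαΓ : Tendsto (fun δ =>
        Real.Gamma (1 - α (smoothedLevel C₂ l ‖plusPart φ lam u l‖ δ)) *
          smoothedLevel C₂ l ‖plusPart φ lam u l‖ δ) (𝓝[>] 0) (𝓝 0)) :
    -- the series defining the reconstruction converges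
    (∀ᶠ δ in 𝓝[>] 0, ∀ y ∈ Ioo 0 ℓ,
      InSpectralDomain φ lam (regSymbol (α (smoothedLevel C₂ l ‖plusPart φ lam u l‖ δ)) y)
        (landweber (smoothingOp φ lam μ (σ + 1)) (plusData φ lam (fδ δ) (gδ δ)) (iStar δ))) ∧
    -- and the reconstruction converges to the exact solution
    Tendsto (fun δ => normL2Sobolev φ lam ℓ σ (fun y =>
        u y - reconstruction φ lam (α (smoothedLevel C₂ l ‖plusPart φ lam u l‖ δ))
          (landweber (smoothingOp φ lam μ (σ + 1)) (plusData φ lam (fδ δ) (gδ δ)) (iStar δ))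
          (minusData φ lam f g) y))
      (𝓝[>] 0) (𝓝 0) := by
  have hd : 0 < d := dimension_pos_of_hilbertBasis φ
  have hlpos : ∀ j, 0 < lam j := fun j =>
    (hφ j).eigenvalue_pos hd hΩb (φ.orthonormal.ne_zero j)
  have hℓ : 0 < ℓ := hl.1.trans hl.2
  have hw0 : ∀ j, 0 ≤ μ * lam j ^ (-(σ + 1)) := fun j =>
    mul_nonneg hμ.le (Real.rpow_nonneg (hlpos j).le _)
  have hw1 : ∀ j, μ * lam j ^ (-(σ + 1)) ≤ 1 := by
    intro j
    have h := hA (φ j)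
    rw [smoothingOp, spectralMul_basis, norm_smul, φ.orthonormal.1 j, mul_one,
      Real.norm_of_nonneg (hw0 j)] at h
    exact h
  have hwabs : ∀ j, |μ * lam j ^ (-(σ + 1))| ≤ 1 := fun j => by
    rw [abs_of_nonneg (hw0 j)]; exact hw1 j
  have hσ1 : 0 < σ + 1 := by linarith
  -- The norm bound on `A`, tested on eigenfunctions, gives `μ ≤ λⱼ^(σ+1)` and hence a uniform
  -- spectral gap.
  obtain ⟨lam0, hlam0, hlam⟩ : ∃ lam0, 0 < lam0 ∧ ∀ j, lam0 ≤ lam j := by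
    refine ⟨μ ^ (1 / (σ + 1)), by positivity, fun j => ?_⟩
    have h := hw1 j
    have hp : 0 < lam j ^ (σ + 1) := Real.rpow_pos_of_pos (hlpos j) _
    rw [Real.rpow_neg (hlpos j).le, ← div_eq_mul_inv, div_le_one hp] at h
    calc μ ^ (1 / (σ + 1)) ≤ (lam j ^ (σ + 1)) ^ (1 / (σ + 1)) := by gcongr
      _ = lam j := by
        rw [← Real.rpow_mul (hlpos j).le, mul_one_div_cancel hσ1.ne', Real.rpow_one]
  have hmode := fun y (hy : y ∈ Ioo 0 ℓ) => hu.inner_eq hφ hlam0 hlam hy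
  set P := plusData φ lam f g with hP
  set M := ‖plusPart φ lam u l‖ with hM
  set A := smoothingOp φ lam μ (σ + 1) with hAdef
  set b : ℝ → L2 Ω := fun δ => plusData φ lam (fδ δ) (gδ δ) with hb
  rcases (norm_nonneg (plusPart φ lam u l)).eq_or_lt with hM0 | hMpos
  · -- the trivial case, in which the unstable component vanishes
    rw [← hM] at hM0
    have hu0 : plusPart φ lam u l = 0 := norm_eq_zero.1 hM0.symm
    have hP0 : ∀ j, inner ℝ (φ j) P = 0 := by
      intro j
      have h := (hmode l hl j).2
      rw [hu0, inner_zero_right] at h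
      exact (mul_eq_zero.1 h.symm).resolve_right (Real.exp_pos _).ne'
    -- Here `log (0 / δ) = 0`, so the exact order forces no iteration at all.
    have hi0 : ∀ᶠ δ in 𝓝[>] 0, iStar δ = 0 := by
      have h := hiStar.1
      simp only [← hM0, zero_div, Real.log_zero, mul_zero] at h
      filter_upwards [isBigO_zero_right_iff.1 h] with δ hδ
      rw [Pi.zero_apply] at hδ
      exact_mod_cast hδ
    refine ⟨?_, ?_⟩
    · filter_upwards [hi0] with δ hδ y hy
      rw [hδ, landweber]
      exact .of_abs_le (v := 0) (C := 0) fun j => by simp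
    · refine tendsto_const_nhds.congr' ?_
      filter_upwards [hi0] with δ hδ
      have hz : ∀ y ∈ Ioo 0 ℓ, sobolevSq φ lam σ (u y - reconstruction φ lam
          (α (smoothedLevel C₂ l M δ)) (landweber A (b δ) (iStar δ))
          (minusData φ lam f g) y) = 0 := by
        intro y hy
        have e : u y - reconstruction φ lam (α (smoothedLevel C₂ l M δ))
            (landweber A (b δ) (iStar δ)) (minusData φ lam f g) y = 0 := by
          refine eq_of_inner_basis_eq φ fun j => ?_
          rw [hδ, landweber, reconstruction, inner_sub_right, inner_add_right,
            (inSpectralDomain_exp hy.1.le _).inner_spectralMul, (hmode y hy j).1, hP0]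
          simp [spectralMul, mul_comm]
        rw [e]
        simp [sobolevSq]
      rw [normL2Sobolev, setLIntegral_congr_fun measurableSet_Ioo hz]
      simp
  rw [← hM] at hMpos
  set L : ℝ → ℝ := fun δ => Real.log (M / δ) with hL
  have hLtop : Tendsto L (𝓝[>] 0) atTop :=
    Real.tendsto_log_atTop.comp (tendsto_inv_nhdsGT_zero.const_mul_atTop hMpos)
  have hl2 : 0 < (l ^ 2)⁻¹ := by have := hl.1; positivity
  -- The lower half of the exact order: infinitely many iterations in the limit, so the filter tends
  -- to one.
  have hitop : Tendsto (fun δ => iStar δ) (𝓝[>] 0) atTop := by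
    have h1 : Tendsto (fun δ => ‖(l ^ 2)⁻¹ * L δ‖) (𝓝[>] 0) atTop :=
      tendsto_norm_atTop_atTop.comp (hLtop.const_mul_atTop hl2)
    have h2 := (hiStar.tendsto_norm_atTop_iff).2 h1
    exact tendsto_natCast_atTop_iff.1 (h2.congr fun δ => Real.norm_natCast _)
  set t : ℝ → ℝ := smoothedLevel C₂ l M with ht
  -- For `δ ≥ M` the square root may vanish, so the order lies in `(0, 1)` only eventually.
  have htpos : ∀ᶠ δ in 𝓝[>] 0, 0 < t δ := by
    filter_upwards [hLtop.eventually_gt_atTop 0, self_mem_nhdsWithin] with δ h1 h2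
    have h3 : (0 : ℝ) < δ := h2
    have h4 : 0 < √(Real.log (M / δ)) := Real.sqrt_pos.2 h1
    have := hl.1
    rw [ht, smoothedLevel]
    positivity
  have hαI : ∀ᶠ δ in 𝓝[>] 0, α (t δ) ∈ Ioo 0 1 := htpos.mono fun δ h => hα _ h
  set X : ℝ → ℕ → ℝ := fun δ j => 1 - (1 - μ * lam j ^ (-(σ + 1))) ^ iStar δ with hX
  have hX0 : ∀ δ j, 0 ≤ X δ j := fun δ j => (smoothing_weight_le (hw0 j) (hw1 j) _).1
  have hX1 : ∀ δ j, X δ j ≤ 1 := fun δ j => (smoothing_weight_le (hw0 j) (hw1 j) _).2.1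
  have hXκ : ∀ δ j, lam j ^ (σ + 1) * X δ j ^ 2 ≤ μ * iStar δ := by
    intro δ j
    have h := (smoothing_weight_le (hw0 j) (hw1 j) (iStar δ)).2.2
    have hp : 0 < lam j ^ (σ + 1) := Real.rpow_pos_of_pos (hlpos j) _
    calc lam j ^ (σ + 1) * X δ j ^ 2
        ≤ lam j ^ (σ + 1) * (iStar δ * (μ * lam j ^ (-(σ + 1)))) := by gcongr
      _ = μ * iStar δ := by rw [Real.rpow_neg (hlpos j).le]; field_simp
  have hXlim : ∀ j, Tendsto (fun δ => X δ j) (𝓝[>] 0) (𝓝 1) := by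
    intro j
    have hp : 0 < μ * lam j ^ (-(σ + 1)) := mul_pos hμ (Real.rpow_pos_of_pos (hlpos j) _)
    have h := (tendsto_pow_atTop_nhds_zero_of_lt_one (r := 1 - μ * lam j ^ (-(σ + 1)))
      (by linarith [hw1 j]) (by linarith)).comp hitop
    simpa [hX] using h.const_sub 1
  have hcoef : ∀ δ j, inner ℝ (φ j) (landweber A (b δ) (iStar δ))
      = X δ j * inner ℝ (φ j) (b δ) := fun δ j => inner_landweber hwabs _ _ _
  refine ⟨?_, ?_⟩
  · filter_upwards [hαI] with δ h1 y hy
    exact inSpectralDomain_regSymbol hlam0 hlam hσ h1.1 h1.2 hy.1.le (hcoef δ) (hX0 δ) (hX1 δ)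
      (hXκ δ)
  -- The upper half of the exact order: `i δ² ≤ c l⁻² log(M/δ) δ² = (c / C₂²) δ̃²`.
  have hrate : Tendsto (fun δ => Real.Gamma (1 - α (t δ)) ^ 2 * (μ * iStar δ) * δ ^ 2)
      (𝓝[>] 0) (𝓝 0) := by
    obtain ⟨c, hc⟩ := hiStar.1.bound
    have hsq := ((hαΓ.pow 2).const_mul (μ * c / C₂ ^ 2))
    rw [zero_pow two_ne_zero, mul_zero] at hsq
    refine tendsto_of_tendsto_of_tendsto_of_le_of_le' tendsto_const_nhds hsq ?_ ?_
    · exact Eventually.of_forall fun δ => by positivity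
    · filter_upwards [hc, hLtop.eventually_gt_atTop 0] with δ h1 h2
      have h2' : 0 < Real.log (M / δ) := h2
      rw [Real.norm_natCast, Real.norm_of_nonneg (by positivity)] at h1
      have hl0 := hl.1
      calc Real.Gamma (1 - α (t δ)) ^ 2 * (μ * iStar δ) * δ ^ 2
          ≤ Real.Gamma (1 - α (t δ)) ^ 2 * (μ * (c * ((l ^ 2)⁻¹ * Real.log (M / δ)))) * δ ^ 2 := by
            gcongr
        _ = μ * c / C₂ ^ 2 * (Real.Gamma (1 - α (t δ)) ^ 2 *
              (C₂ ^ 2 * (l ^ 2)⁻¹ * δ ^ 2 * √(Real.log (M / δ)) ^ 2)) := by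
            rw [Real.sq_sqrt h2'.le]; field_simp
        _ = _ := by rw [ht, smoothedLevel]; ring
  have hreg' : ∫⁻ y in Ioo 0 ℓ, ∑' j, ENNReal.ofReal (lam j ^ (σ + 1 + 1 / p) *
      (inner ℝ (φ j) P * Real.exp (√(lam j) * y)) ^ 2) ≠ ⊤ := by
    rw [normL2Sobolev, ENNReal.rpow_lt_top_iff_of_pos (by norm_num)] at hreg
    rw [setLIntegral_congr_fun measurableSet_Ioo (g := fun y =>
      sobolevSq φ lam (σ + 1 + 1 / p) (plusPart φ lam u y)) fun y hy => ?_]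
    · exact hreg.ne
    · exact tsum_congr fun j => by rw [(hmode y hy j).2]
  exact tendsto_reconstruction hlam0 hlam hℓ hσ (by positivity) (fun y hy j => (hmode y hy j).1)
    hreg' hαI hα1 hnoise hcoef hX0 hX1 hXκ hXlim hrate
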